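/- **Setting.** Let $\mathcal X=\{1,\dots,N\}$ be the set of augmented samples. Let $\mathcal P$ and $\mathcal P_{l}$ be probability distributions of all natural samples and of the labeled natural samples (of one known class), and let $\mathcal T(x\mid\bar x)$ be the probability that $\bar x$ is augmented to $x\in\mathcal X$. Put $$A^{(u)}_{xx'}=\mathbb E_{\bar x\sim\mathcal P}\,\mathcal T(x|\bar x)\mathcal T(x'|\bar x),\qquad \mathfrak l_x=\mathbb E_{\bar x\sim\mathcal P_l}\,\mathcal T(x|\bar x),\qquad A(\delta)=\eta_uA^{(u)}+\delta\,\mathfrak l\mathfrak l^{\top},$$ where $\eta_u A^{(u)}$ has all row sums equal to $1$. Let $D(\delta)$ be the diagonal matrix of row sums of $A(\delta)$, and let $\dot A(\delta)=D(\delta)^{-1/2}A(\delta)D(\delta)^{-1/2}=\sum_{j=1}^N\lambda_j(\delta)v_j(\delta)v_j(\delta)^\top$ be its singular value decomposition, $\lambda_1(\delta)\ge\dots\ge\lambda_N(\delta)\ge0$, $v_j(\delta)$ orthonormal. For $1\le k\le N$, a representation $Z(\delta)\in\mathbb R^{N\times k}$ is any matrix with $Z(\delta)Z(\delta)^\top=D(\delta)^{-1/2}\big(\sum_{j\le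 k}\lambda_j(\delta)v_j(\delta)v_j(\delta)^\top\big)D(\delta)^{-1/2}$. Write $Z=Z(0)$, with rows $\mathbf z_i^\top$, and $V_k=[v_1(0),\dots,v_k(0)]$. The spectral gap is $\mathcal G_k=\lambda_k(0)/\lambda_{k+1}(0)\in[0,\infty]$, with $\lambda_{N+1}(0)=0$, equal to $\infty$ if $\lambda_k(0)>0=\lambda_{k+1}(0)$ and to $0$ if $\lambda_k(0)=0$. For a partition $\Pi$ of $\mathcal X$ into nonempty classes, let $\boldsymbol\mu_\pi$ and $\boldsymbol\mu_\Pi$ be the means of the rows of $Z$ over $\pi$ and over $\mathcal X$, $$\mathcal M_{\rm intra}(\Pi,Z)=\sum_{\pi\in\Pi}\sum_{i\in\pi}\|\mathbf z_i-\boldsymbol\mu_\pi\|^2,\quad \mathcal M_{\rm inter}(\Pi,Z)=\sum_{\pi\in\Pi}|\pi|\,\|\boldsymbol\mu_\pi-\boldsymbol\mu_\Pi\|^2,\quad \mathcal M_{kms}=\mathcal M_{\rm intra}/\mathcal M_{\rm inter},$$ and $\Delta_{kms}(\delta)=\mathcal M_{kms}(\Pi,Z)-\mathcal M_{kms}(\Pi,Z(\delta))$.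 **Assumptions.** $\mathfrak l$ lies in the column span of $V_k$; $\mathfrak l$ is constant, equal to $\mathfrak l_{\pi_c}$, on each class $\pi_c\in\Pi$; $\mathcal M_{\rm inter}(\Pi,Z)>0$; $\delta>0$. Put $\eta_1=1/\mathcal M_{\rm inter}(\Pi,Z)$, $\eta_2=\mathcal M_{\rm intra}(\Pi,Z)/\mathcal M_{\rm inter}(\Pi,Z)$, $$S_{\pi_c}=2\Big(1-\frac{|\pi_c|}N\Big)\Big(\mathbb E_{i\in\pi_c}\mathbb E_{j\in\pi_c}\mathbf z_i^\top\mathbf z_j-\mathbb E_{i\in\pi_c}\mathbb E_{j\notin\pi_c}\mathbf z_i^\top\mathbf z_j\Big),\qquad \Delta_{\pi_c}=\Big(\mathfrak l_{\pi_c}-\frac1N\Big)-S_{\pi_c}$$ (with $S_{\pi_c}=0$ if $\pi_c=\mathcal X$). **Theorem.** Let $N$ and $B$ be given. There are constants $G_0,\delta_0,C>0$ depending only on $N$ and $B$, and for every $s>0$ constants $G_1,\delta_1>0$ depending only on $N,B,s$, such that for all data as above with $\eta_1\le B$: 1. If $\mathcal G_k\ge G_0$ and $\delta\le\delta_0$,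 then $$\Delta_{kms}(\delta)\ \ge\ \delta\,\eta_1\eta_2\sum_{\pi_c\in\Pi}|\pi_c|\,\mathfrak l_{\pi_c}\,\Delta_{\pi_c}\;-\;C\Big(\frac{\delta}{\mathcal G_k}+\delta^2\Big).$$ 2. If $\mathcal G_k\ge G_1$, $\delta\le\delta_1$ and $\sum_{\pi_c\in\Pi}\mathfrak l_{\pi_c}\sum_{i\in\pi_c}\|\mathbf z_i-\boldsymbol\mu_{\pi_c}\|^2\ge s$ (the classes connected to the labeled data are not already collapsed to points), then $$\Delta_{kms}(\delta)\ \ge\ \delta\,\eta_1\eta_2\sum_{\pi_c\in\Pi}|\pi_c|\,\mathfrak l_{\pi_c}\,\Delta_{\pi_c};$$ if moreover $\mathfrak l_{\pi_c}-\frac1N>S_{\pi_c}$ for every class with $\mathfrak l_{\pi_c}>0$, then $\Delta_{kms}(\delta)>0$, that is, adding the labels improves the clustering. 3. For each class with $\mathfrak l_{\pi_c}>0$, its contribution $|\pi_c|\,\mathfrak l_{\pi_c}\Delta_{\pi_c}$ is positive if and only if $\mathfrak l_{\pi_c}-\frac1N>S_{\pi_c}$, i.e. its connection to the labeled data exceeds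 its self-clusterability. -/

import Mathlib

open MeasureTheory ProbabilityTheory
open scoped ENNReal

noncomputable section

namespace SORL

/-! ### The augmentation graph

The vertices are the `N` augmented samples, indexed by `Fin N`.  Natural samples live in a measurable
space `Ω`, and `T ω {x}` is the probability that `x` is an augmentation of the natural sample `ω`. -/

section Graph

variable {N : ℕ} {Ω : Type*} [MeasurableSpace Ω]

/-- Self-supervised connectivity: the probability that `x` and `y` are two augmentations of the same
natural sample drawn from `P`. -/
def selfAdj (P : Measure Ω) (T : Kernel Ω (Fin N)) : Matrix (Fin N) (Fin N) ℝ :=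
  fun x y => ∫ ω, (T ω).real {x} * (T ω).real {y} ∂P

/-- Connection of the vertex `x` to the labeled data: the probability that `x` is an augmentation of
a labeled natural sample drawn from `Pl`. -/
def labelConn (Pl : Measure Ω) (T : Kernel Ω (Fin N)) : Fin N → ℝ :=
  fun x => ∫ ω, (T ω).real {x} ∂Pl

/-- The adjacency matrix `ηu • A⁽ᵘ⁾ + δ • l lᵀ`, one known class being labeled with weight `δ`. -/
def adj (ηu : ℝ) (P Pl : Measure Ω) (T : Kernel Ω (Fin N)) (δ : ℝ) : Matrix (Fin N) (Fin N) ℝ :=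
  ηu • selfAdj P T + δ • Matrix.vecMulVec (labelConn Pl T) (labelConn Pl T)

end Graph

/-! ### Spectral representations -/

/-- Degree (total edge weight) of a vertex. -/
def deg {N : ℕ} (A : Matrix (Fin N) (Fin N) ℝ) (x : Fin N) : ℝ := ∑ y, A x y

/-- The normalized adjacency matrix `D^(-1/2) A D^(-1/2)`. -/
def normAdj {N : ℕ} (A : Matrix (Fin N) (Fin N) ℝ) : Matrix (Fin N) (Fin N) ℝ :=
  fun x y => (√(deg A x))⁻¹ * A x y * (√(deg A y))⁻¹

/-- A singular value decomposition `M = ∑ j, σ j • v j (v j)ᵀ` of a symmetric positive semidefinite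
matrix, with the singular values in decreasing order. -/
structure IsSVD {N : ℕ} (M : Matrix (Fin N) (Fin N) ℝ) (σ : Fin N → ℝ)
    (v : Fin N → EuclideanSpace ℝ (Fin N)) : Prop where
  antitone : Antitone σ
  nonneg : ∀ j, 0 ≤ σ j
  orthonormal : Orthonormal ℝ v
  eq_sum : ∀ x y, M x y = ∑ j, σ j * v j x * v j y

/-- `Z` (row `Z x` is the feature of the vertex `x`) is a `k`-dimensional spectral representation of
the graph with adjacency matrix `A`: `Z Zᵀ = D^(-1/2) Ȧ_k D^(-1/2)`, where `Ȧ_k` consists of the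
top-`k` components of the singular value decomposition `(σ, v)` of the normalized adjacency matrix. -/
structure IsSpectralRep {N k : ℕ} (A : Matrix (Fin N) (Fin N) ℝ) (σ : Fin N → ℝ)
    (v : Fin N → EuclideanSpace ℝ (Fin N)) (Z : Fin N → EuclideanSpace ℝ (Fin k)) : Prop where
  svd : IsSVD (normAdj A) σ v
  gram : ∀ x y, inner ℝ (Z x) (Z y) =
    (√(deg A x))⁻¹ * (∑ j with j.val < k, σ j * v j x * v j y) * (√(deg A y))⁻¹

/-- The `j`-th singular value (`j = 1, 2, …`), and `0` beyond the size of the matrix. -/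
def singVal {N : ℕ} (σ : Fin N → ℝ) (j : ℕ) : ℝ := if h : j - 1 < N then σ ⟨j - 1, h⟩ else 0

/-- The spectral gap: the ratio of the `k`-th and the `(k+1)`-th singular value; it is `∞` if the
former is positive and the latter vanishes. -/
def spectralGap {N : ℕ} (σ : Fin N → ℝ) (k : ℕ) : ℝ≥0∞ :=
  ENNReal.ofReal (singVal σ k) / ENNReal.ofReal (singVal σ (k + 1))

/-! ### The K-means measure -/

section KMeans

variable {N k : ℕ}

/-- Average of the features over a set of vertices. -/
def center (Z : Fin N → EuclideanSpace ℝ (Fin k)) (s : Finset (Fin N)) :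
    EuclideanSpace ℝ (Fin k) :=
  (s.card : ℝ)⁻¹ • ∑ i ∈ s, Z i

def intraClass (Q : Finpartition (Finset.univ : Finset (Fin N)))
    (Z : Fin N → EuclideanSpace ℝ (Fin k)) : ℝ :=
  ∑ c ∈ Q.parts, ∑ i ∈ c, ‖Z i - center Z c‖ ^ 2

def interClass (Q : Finpartition (Finset.univ : Finset (Fin N)))
    (Z : Fin N → EuclideanSpace ℝ (Fin k)) : ℝ :=
  ∑ c ∈ Q.parts, (c.card : ℝ) * ‖center Z c - center Z Finset.univ‖ ^ 2

/-- The K-means measure. -/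
def kms (Q : Finpartition (Finset.univ : Finset (Fin N)))
    (Z : Fin N → EuclideanSpace ℝ (Fin k)) : ℝ :=
  intraClass Q Z / interClass Q Z

/-- Average similarity of the features of two sets of vertices. -/
def meanSim (Z : Fin N → EuclideanSpace ℝ (Fin k)) (s t : Finset (Fin N)) : ℝ :=
  (s.card : ℝ)⁻¹ * ∑ i ∈ s, (t.card : ℝ)⁻¹ * ∑ j ∈ t, inner ℝ (Z i) (Z j)

/-- Intra-class similarity minus inter-class similarity of the class `c`, weighted by
`2 * (1 - |c| / N)`. -/
def selfClusterability (Z : Fin N → EuclideanSpace ℝ (Fin k)) (c : Finset (Fin N)) : ℝ :=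
  2 * (1 - (c.card : ℝ) / N) * (meanSim Z c c - meanSim Z c cᶜ)

/-- Class-wise perturbation of the K-means measure; `lc` is the connection of the class `c` to the
labeled data. -/
def classPert (Z : Fin N → EuclideanSpace ℝ (Fin k)) (lc : ℝ) (c : Finset (Fin N)) : ℝ :=
  (lc - 1 / (N : ℝ)) - selfClusterability Z c

end KMeans

end SORL

end

/-! Write `A` for the unlabeled adjacency matrix (all degrees one), `D` for the degree matrix after
labeling, with entries `1 + δ l x`, and `H = D^(1/2)`, `S = H⁻¹`. If `M` is the labeled normalized
matrix, then `H M H = A + δ l lᵀ`. Because `l` lies in the top-`k` eigenspace, with projection `P`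
and complement `Q`, the right side is block diagonal: a block `B = P A P + δ l lᵀ`, at least `λ_k`
on the range of `P`, and a block `C = Q A Q` of norm at most `λ_{k+1}`.

Split `M = X + Y` into its top-`k` part and the rest. Were `S = 1`, a large gap would force `H X H =
B` exactly. In general `X Y = 0` turns into orthogonality of `H X H` and `H Y H` with respect to
`S²`, and `‖1 - S²‖ ≤ δ`, so the mismatch is `O(δ / gap)` (`norm_congr_sub_le`,
`norm_truncation_sub_le`). No gaps inside the top-`k` cluster are needed. Min-max arguments
(`singVal_congr_le`, `le_singVal_congr`) show that the spectrum of `M` is still separated at `k`.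

The new Gram matrix is `S X S = S² (H X H) S²`. Expanding `S²` in `δ` gives `Γ + δ (l_x l_y - (l_x +
l_y) Γ_xy)` up to `O(δ / gap + δ²)` (`abs_gram_sub_le`). Both scatters are linear in the Gram
matrix. For `l` constant on classes, the derivative of the inter-class scatter is the sum of the
terms `|c| l_c Δ_c` (`interSim_simPert`), and that of the intra-class scatter is `-2 ∑ l_c
scatter(c)` (`intraSim_simPert`). The quotient rule (`abs_div_sub_div_sub_le`) yields the asserted
main term plus `2 δ η₁ ∑ l_c scatter(c) ≥ 0`. This surplus is dropped in the first claim and absorbs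
the error in the second. -/

namespace SORL

/-! ### Operators diagonal in an orthonormal basis -/

section Operators

variable {ι E : Type*} [Fintype ι] [NormedAddCommGroup E] [InnerProductSpace ℝ E]

/-- The operator with eigenvalues `σ j` and eigenvectors `b j`. -/
noncomputable def specOp (b : OrthonormalBasis ι ℝ E) (σ : ι → ℝ) : E →L[ℝ] E :=
  ∑ j, σ j • (innerSL ℝ (b j)).smulRight (b j)

variable (b : OrthonormalBasis ι ℝ E) (σ τ : ι → ℝ)

lemma specOp_apply (x : E) : specOp b σ x = ∑ j, (σ j * inner ℝ (b j) x) • b j := by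
  simp [specOp, smul_smul]

lemma specOp_basis (j : ι) : specOp b σ (b j) = σ j • b j := by
  classical
  rw [specOp_apply, Finset.sum_eq_single j]
  · simp
  · intro i _ hij
    simp [b.inner_eq_zero hij]
  · simp

lemma clm_ext_basis {f g : E →L[ℝ] E} (h : ∀ j, f (b j) = g (b j)) : f = g := by
  apply ContinuousLinearMap.coe_injective
  apply b.toBasis.ext
  simpa using h

lemma specOp_mul : specOp b σ * specOp b τ = specOp b (fun j => σ j * τ j) :=
  clm_ext_basis b fun j => by
    simp [specOp_basis, smul_smul, mul_comm]

lemma specOp_add : specOp b σ + specOp b τ = specOp b (fun j => σ j + τ j) :=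
  clm_ext_basis b fun j => by simp [specOp_basis, add_smul]

lemma specOp_one : specOp b (fun _ => 1) = 1 :=
  clm_ext_basis b fun j => by simp [specOp_basis]

lemma specOp_zero : specOp b (fun _ => 0) = 0 :=
  clm_ext_basis b fun j => by simp [specOp_basis]

lemma one_sub_specOp : 1 - specOp b σ = specOp b (fun j => 1 - σ j) :=
  clm_ext_basis b fun j => by simp [specOp_basis, sub_smul]

lemma inner_specOp (x y : E) :
    inner ℝ x (specOp b σ y) = ∑ j, σ j * inner ℝ (b j) x * inner ℝ (b j) y := by
  rw [specOp_apply, inner_sum]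
  refine Finset.sum_congr rfl fun j _ => ?_
  rw [inner_smul_right, real_inner_comm (b j) x]
  ring

lemma specOp_symm (x y : E) : inner ℝ (specOp b σ x) y = inner ℝ x (specOp b σ y) := by
  rw [real_inner_comm, inner_specOp, inner_specOp]
  exact Finset.sum_congr rfl fun j _ => by ring

lemma inner_basis_specOp (j : ι) (x : E) :
    inner ℝ (b j) (specOp b σ x) = σ j * inner ℝ (b j) x := by
  rw [← specOp_symm, specOp_basis, real_inner_smul_left]

lemma norm_sq_eq_sum_inner (x : E) : ‖x‖ ^ 2 = ∑ j, inner ℝ (b j) x ^ 2 :=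
  (b.sum_sq_inner_right x).symm

lemma norm_specOp_le {m : ℝ} (hm : 0 ≤ m) (h : ∀ j, |σ j| ≤ m) : ‖specOp b σ‖ ≤ m := by
  refine ContinuousLinearMap.opNorm_le_bound _ hm fun x => ?_
  refine le_of_sq_le_sq ?_ (by positivity)
  rw [mul_pow, norm_sq_eq_sum_inner b, norm_sq_eq_sum_inner b x, Finset.mul_sum]
  refine Finset.sum_le_sum fun j _ => ?_
  rw [inner_basis_specOp, mul_pow]
  have := sq_le_sq' (by linarith [neg_abs_le (σ j), h j]) (le_of_abs_le (h j))
  gcongr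

end Operators

/-- An `n`-dimensional space contains a nonzero vector orthogonal to `n - 1` given vectors. -/
lemma exists_ne_zero_inner_eq_zero {N : ℕ} (i₀ : Fin N)
    (g : Fin N → EuclideanSpace ℝ (Fin N)) :
    ∃ x : EuclideanSpace ℝ (Fin N), x ≠ 0 ∧ ∀ i, i ≠ i₀ → inner ℝ (g i) x = 0 := by
  let f : EuclideanSpace ℝ (Fin N) →ₗ[ℝ] ({i : Fin N // i ≠ i₀} → ℝ) :=
    LinearMap.pi fun i => (innerSL ℝ (g i)).toLinearMap
  have hlt : Module.finrank ℝ ({i : Fin N // i ≠ i₀} → ℝ)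
      < Module.finrank ℝ (EuclideanSpace ℝ (Fin N)) := by
    simp only [Module.finrank_fintype_fun_eq_card, finrank_euclideanSpace, ne_eq,
      Fintype.card_subtype_compl, Fintype.card_fin, Fintype.card_unique]
    have := i₀.pos
    omega
  obtain ⟨x, hx, hx0⟩ := Submodule.exists_mem_ne_zero_of_ne_bot
    (LinearMap.ker_ne_bot_of_finrank_lt (f := f) hlt)
  refine ⟨x, hx0, fun i hi => ?_⟩
  have := congrFun (LinearMap.mem_ker.1 hx) ⟨i, hi⟩
  simpa [f] using this

/-! ### Perturbation of a spectral truncation under congruence -/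

/-- Let `B + C` be a block diagonal element of a normed ring for the complementary idempotents
`P`, `Q`, and let `X + Y` with `X * Y = 0` be its congruence transform by `S = H⁻¹`. If the block `B`
and the part `X` dominate `C` and `Y`, then `H * X * H` is close to `B`. -/
lemma norm_congr_sub_le {𝒜 : Type*} [NormedRing 𝒜]
    {P Q B C H S X Y X' : 𝒜} {a b δ : ℝ} (ha : 0 < a) (hb : 0 ≤ b) (hab : 16 * b ≤ a) (hδ : 0 ≤ δ)
    (hPQ : P + Q = 1) (hPB : P * B = B) (hPC : P * C = 0) (hCQ : C * Q = C)
    (hHS : H * S = 1) (hSH : S * H = 1) (hXY : X * Y = 0) (hYX : Y * X = 0)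
    (hX' : X * X * X' = X) (hsum : H * (X + Y) * H = B + C)
    (hP1 : ‖P‖ ≤ 1) (hQ1 : ‖Q‖ ≤ 1) (hC : ‖C‖ ≤ b) (hY : ‖Y‖ ≤ b) (hX'a : ‖X'‖ ≤ 4 / a)
    (hS1 : ‖S‖ ≤ 1) (hH2 : ‖H‖ ≤ 2) (hSS : ‖1 - S * S‖ ≤ δ)
    (hB : ∀ K, a * ‖P * K‖ ≤ ‖B * K‖) :
    ‖H * X * H - B‖ ≤ 8 * δ * b + 16 * (b / a) * δ * (‖B‖ + 5 * b) := by
  obtain ⟨T, hT⟩ : ∃ T, T = H * X * H := ⟨_, rfl⟩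
  obtain ⟨R, hR⟩ : ∃ R, R = H * Y * H := ⟨_, rfl⟩
  have hTR : T + R = B + C := by rw [hT, hR, ← hsum]; noncomm_ring
  have hQ : Q = 1 - P := by rw [← hPQ]; abel
  have hQB : Q * B = 0 := by rw [hQ, sub_mul, hPB, one_mul, sub_self]
  have hQC : Q * C = C := by rw [hQ, sub_mul, hPC, one_mul, sub_zero]
  -- Orthogonality of `X` and `Y` survives the congruence as orthogonality with respect to `S * S`.
  have hTKR : T * (S * S * R) = 0 := by
    calc T * (S * S * R) = H * X * (H * S) * (S * H) * Y * H := by rw [hT, hR]; noncomm_ring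
      _ = H * (X * Y) * H := by rw [hHS, hSH]; noncomm_ring
      _ = 0 := by rw [hXY]; simp
  have hRJT : R * (S * S * T) = 0 := by
    calc R * (S * S * T) = H * Y * (H * S) * (S * H) * X * H := by rw [hT, hR]; noncomm_ring
      _ = H * (Y * X) * H := by rw [hHS, hSH]; noncomm_ring
      _ = 0 := by rw [hYX]; simp
  have hRb : ‖R‖ ≤ 4 * b := by
    calc ‖R‖ ≤ ‖H‖ * ‖Y‖ * ‖H‖ := by rw [hR]; exact norm_mul₃_le
      _ ≤ 2 * b * 2 := by gcongr
      _ = 4 * b := by ring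
  have hTb : ‖T‖ ≤ ‖B‖ + 5 * b := by
    have : T = B + C - R := by rw [← hTR]; abel
    rw [this]
    linarith [norm_sub_le (B + C) R, norm_add_le B C]
  -- Since `P T = B - P R` kills `S² R`, one has `B (S² R) = P R (S² R)`. The lower bound `a` for
  -- `B` and `‖S² R‖ ≤ 4 b` make `‖P S² R‖` at most `‖P R‖ / 4`, and replacing `S²` by `1` costs `4
  -- δ b`; the quarter is then absorbed.
  have hPR : ‖P * R‖ ≤ 8 * δ * b := by
    have e1 : B * (S * S * R) = P * R * (S * S * R) := by
      have : P * T = B - P * R := by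
        rw [eq_sub_iff_add_eq, ← mul_add, hTR, mul_add, hPB, hPC, add_zero]
      have h2 : P * T * (S * S * R) = 0 := by rw [mul_assoc, hTKR, mul_zero]
      rw [this, sub_mul, sub_eq_zero] at h2
      exact h2
    have e2 : P * R = P * (S * S * R) + P * (1 - S * S) * R := by noncomm_ring
    have h3 : ‖S * S * R‖ ≤ 4 * b := by
      calc ‖S * S * R‖ ≤ ‖S‖ * ‖S‖ * ‖R‖ := norm_mul₃_le
        _ ≤ 1 * 1 * (4 * b) := by gcongr
        _ = 4 * b := by ring
    have h4 : a * ‖P * (S * S * R)‖ ≤ ‖P * R‖ * (4 * b) := by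
      refine (hB _).trans ?_
      rw [e1]
      exact (norm_mul_le _ _).trans (by gcongr)
    have h5 : ‖P * (1 - S * S) * R‖ ≤ 4 * δ * b := by
      calc _ ≤ ‖P‖ * ‖1 - S * S‖ * ‖R‖ := norm_mul₃_le
        _ ≤ 1 * δ * (4 * b) := by gcongr
        _ = _ := by ring
    have h6 : ‖P * R‖ ≤ ‖P * (S * S * R)‖ + 4 * δ * b := by
      calc ‖P * R‖ = ‖P * (S * S * R) + P * (1 - S * S) * R‖ := by rw [← e2]
        _ ≤ _ := (norm_add_le _ _).trans (by gcongr)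
    have h7 : ‖P * (S * S * R)‖ ≤ ‖P * R‖ / 4 := by
      have : a * ‖P * (S * S * R)‖ ≤ a * (‖P * R‖ / 4) := by
        nlinarith [norm_nonneg (P * R)]
      exact le_of_mul_le_mul_left this ha
    nlinarith [mul_nonneg hδ hb]
  -- The mirror argument: `Q R = C - Q T` kills `S² T`. A factor `T` is recovered from `T S² T` by
  -- the pseudo-inverse `S X' H`, of norm at most `8 / a`; since `8 b / a ≤ 1/2`, the term `‖Q T‖`
  -- on the right is absorbed.
  have hQT : ‖Q * T‖ ≤ 16 * (b / a) * δ * ‖T‖ := by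
    have e1 : Q * T * (S * S * T) = C * (Q * (S * S * T)) := by
      have : Q * R = C - Q * T := by
        rw [eq_sub_iff_add_eq, ← mul_add, add_comm R, hTR, mul_add, hQB, hQC, zero_add]
      have h2 : Q * R * (S * S * T) = 0 := by rw [mul_assoc, hRJT, mul_zero]
      rw [this, sub_mul, sub_eq_zero] at h2
      rw [← h2, ← mul_assoc C Q, hCQ]
    have e2 : T * (S * S * T) * (S * X' * H) = T := by
      calc T * (S * S * T) * (S * X' * H)
          = H * X * (H * S) * (S * H) * X * (H * S) * X' * H := by rw [hT]; noncomm_ring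
        _ = H * (X * X * X') * H := by rw [hHS, hSH]; noncomm_ring
        _ = T := by rw [hX', hT]
    have e3 : Q * T = C * (Q * (S * S * T)) * (S * X' * H) := by
      rw [← e1, mul_assoc Q, mul_assoc Q, e2]
    have h3 : ‖S * X' * H‖ ≤ 8 / a := by
      calc _ ≤ ‖S‖ * ‖X'‖ * ‖H‖ := norm_mul₃_le
        _ ≤ 1 * (4 / a) * 2 := by gcongr
        _ = _ := by ring
    have h4 : ‖Q * (S * S * T)‖ ≤ ‖Q * T‖ + δ * ‖T‖ := by
      have : Q * (S * S * T) = Q * T - Q * (1 - S * S) * T := by noncomm_ring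
      rw [this]
      refine (norm_sub_le _ _).trans ?_
      gcongr
      calc _ ≤ ‖Q‖ * ‖1 - S * S‖ * ‖T‖ := norm_mul₃_le
        _ ≤ 1 * δ * ‖T‖ := by gcongr
        _ = _ := by ring
    have h5 : ‖Q * T‖ ≤ b * (‖Q * T‖ + δ * ‖T‖) * (8 / a) := by
      calc ‖Q * T‖ = ‖C * (Q * (S * S * T)) * (S * X' * H)‖ := by rw [← e3]
        _ ≤ ‖C‖ * ‖Q * (S * S * T)‖ * ‖S * X' * H‖ := norm_mul₃_le
        _ ≤ _ := by gcongr
    have h6 : b / a ≤ 1 / 16 := by rw [div_le_div_iff₀ ha (by norm_num)]; linarith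
    have h7 : b * (‖Q * T‖ + δ * ‖T‖) * (8 / a)
        = 8 * (b / a) * ‖Q * T‖ + 8 * (b / a) * δ * ‖T‖ := by ring
    have h8 := mul_le_mul_of_nonneg_right h6 (norm_nonneg (Q * T))
    linarith
  have hfin : H * X * H - B = Q * T - P * R := by
    have h1 : T = P * T + Q * T := by rw [← add_mul, hPQ, one_mul]
    have h2 : P * T = B - P * R := by
      rw [eq_sub_iff_add_eq, ← mul_add, hTR, mul_add, hPB, hPC, add_zero]
    rw [← hT]
    nth_rewrite 1 [h1]
    rw [h2]
    abel
  rw [hfin]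
  have h9 : 16 * (b / a) * δ * ‖T‖ ≤ 16 * (b / a) * δ * (‖B‖ + 5 * b) := by gcongr
  linarith [norm_sub_le (Q * T) (P * R)]

section Truncation

variable {N : ℕ}

/-- The operator `x ↦ ⟪l, x⟫ • l`. -/
noncomputable def outerOp (l : EuclideanSpace ℝ (Fin N)) :
    EuclideanSpace ℝ (Fin N) →L[ℝ] EuclideanSpace ℝ (Fin N) :=
  (innerSL ℝ l).smulRight l

lemma outerOp_apply (l x : EuclideanSpace ℝ (Fin N)) : outerOp l x = (inner ℝ l x : ℝ) • l := by
  simp [outerOp]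

lemma inner_outerOp (l x y : EuclideanSpace ℝ (Fin N)) :
    inner ℝ x (outerOp l y) = inner ℝ l x * inner ℝ l y := by
  rw [outerOp_apply, inner_smul_right, real_inner_comm l x, mul_comm]

lemma norm_outerOp_le {l : EuclideanSpace ℝ (Fin N)} (hl : ‖l‖ ≤ 1) : ‖outerOp l‖ ≤ 1 := by
  refine ContinuousLinearMap.opNorm_le_bound _ zero_le_one fun x => ?_
  rw [outerOp_apply, norm_smul]
  calc ‖(inner ℝ l x : ℝ)‖ * ‖l‖ ≤ (‖l‖ * ‖x‖) * ‖l‖ := by gcongr; exact norm_inner_le_norm l x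
    _ ≤ (1 * ‖x‖) * 1 := by gcongr
    _ = 1 * ‖x‖ := by ring

lemma inner_eq_zero_of_mem_span {k : ℕ} {b : Fin N → EuclideanSpace ℝ (Fin N)}
    {l x : EuclideanSpace ℝ (Fin N)} (hl : l ∈ Submodule.span ℝ (b '' {j | j.val < k}))
    (hx : ∀ j : Fin N, j.val < k → inner ℝ (b j) x = 0) : inner ℝ l x = 0 := by
  induction hl using Submodule.span_induction with
  | mem y hy => obtain ⟨j, hj, rfl⟩ := hy; exact hx j hj
  | zero => simp
  | add y z _ _ hy hz => rw [inner_add_left, hy, hz, add_zero]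
  | smul c y _ hy => rw [real_inner_smul_left, hy, mul_zero]

variable {k : ℕ} {b b' : OrthonormalBasis (Fin N) ℝ (EuclideanSpace ℝ (Fin N))}
  {σ σ' : Fin N → ℝ} {l : EuclideanSpace ℝ (Fin N)} {δ lo hi : ℝ}
  {H S : EuclideanSpace ℝ (Fin N) →L[ℝ] EuclideanSpace ℝ (Fin N)}

/-- Singular values beyond the `k`-th do not increase under a rank-one update in the span of the
first `k` singular vectors followed by a contracting congruence. -/
lemma singVal_congr_le (hσ'anti : Antitone σ')
    (hl : l ∈ Submodule.span ℝ (b '' {j | j.val < k}))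
    (hSsymm : ∀ x y, inner ℝ (S x) y = inner ℝ x (S y)) (hS1 : ‖S‖ ≤ 1)
    (hM : specOp b' σ' = S * (specOp b σ + δ • outerOp l) * S)
    (hhi0 : 0 ≤ hi) (hhi : ∀ j : Fin N, k ≤ j.val → σ j ≤ hi)
    (j : Fin N) (hj : k ≤ j.val) : σ' j ≤ hi := by
  have hkN : k < N := hj.trans_lt j.isLt
  refine (hσ'anti (show (⟨k, hkN⟩ : Fin N) ≤ j from hj)).trans ?_
  -- Courant–Fischer test vector: `u` lies in the span of the first `k + 1` vectors of `b'`, while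
  -- `S u` is orthogonal to the first `k` vectors of `b`, hence to `l`, so the rank-one update is
  -- invisible to it.
  obtain ⟨u, hu0, hu⟩ := exists_ne_zero_inner_eq_zero (⟨k, hkN⟩ : Fin N)
    (fun i => if i.val < k then S (b i) else b' i)
  have hu1 : ∀ i : Fin N, i.val < k → inner ℝ (b i) (S u) = 0 := fun i hi => by
    have := hu i (by rintro rfl; simp at hi)
    rwa [if_pos hi, hSsymm] at this
  have hu2 : ∀ i : Fin N, k < i.val → inner ℝ (b' i) u = 0 := fun i hi => by
    have := hu i (by rintro rfl; simp at hi)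
    rwa [if_neg hi.not_gt] at this
  have hlu := inner_eq_zero_of_mem_span hl hu1
  have hupos : 0 < ‖u‖ ^ 2 := by positivity
  have h1 : σ' ⟨k, hkN⟩ * ‖u‖ ^ 2 ≤ inner ℝ u (specOp b' σ' u) := by
    rw [inner_specOp, norm_sq_eq_sum_inner b' u, Finset.mul_sum]
    refine Finset.sum_le_sum fun i _ => ?_
    rcases le_or_gt i.val k with h | h
    · have := hσ'anti (show i ≤ ⟨k, hkN⟩ from h)
      rw [mul_assoc, ← sq]
      gcongr
    · rw [hu2 i h]; simp
  have h2 : inner ℝ u (specOp b' σ' u) ≤ hi * ‖u‖ ^ 2 := by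
    have e : inner ℝ u (specOp b' σ' u) = inner ℝ (S u) (specOp b σ (S u)) := by
      rw [hM]
      simp only [mul_apply_eq_comp, add_apply,
        smul_apply, outerOp_apply, hlu]
      rw [← hSsymm]
      simp
    have hSu : ‖S u‖ ≤ ‖u‖ := by simpa using S.le_of_opNorm_le hS1 u
    calc inner ℝ u (specOp b' σ' u) ≤ hi * ‖S u‖ ^ 2 := by
          rw [e, inner_specOp, norm_sq_eq_sum_inner b, Finset.mul_sum]
          refine Finset.sum_le_sum fun i _ => ?_
          rcases lt_or_ge i.val k with h | h
          · rw [hu1 i h]; simp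
          · rw [mul_assoc, ← sq]
            have := hhi i h
            gcongr
      _ ≤ _ := by gcongr
  exact le_of_mul_le_mul_right (h1.trans h2) hupos

/-- The first `k` singular values decrease at most by the factor `4` under a positive rank-one
update followed by a congruence whose inverse has norm at most `2`. -/
lemma le_singVal_congr (hδ : 0 ≤ δ) (hσ'anti : Antitone σ') (hσ'0 : ∀ j, 0 ≤ σ' j)
    (hHsymm : ∀ x y, inner ℝ (H x) y = inner ℝ x (H y)) (hH2 : ‖H‖ ≤ 2)
    (hM : H * specOp b' σ' * H = specOp b σ + δ • outerOp l)
    (hlo : ∀ j : Fin N, j.val < k → lo ≤ σ j)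
    (j : Fin N) (hj : j.val < k) : lo / 4 ≤ σ' j := by
  -- Here `x` is in the span of `b i` with `i ≤ j`, so its quadratic form is at least `lo`, while `H
  -- x` is orthogonal to `b' i` for `i < j`, so the form is at most `σ' j * ‖H x‖ ^ 2`. The factor
  -- `4` is the bound for `‖H‖ ^ 2`.
  obtain ⟨x, hx0, hx⟩ := exists_ne_zero_inner_eq_zero j
    (fun i => if i < j then H (b' i) else b i)
  have hx1 : ∀ i, i < j → inner ℝ (b' i) (H x) = 0 := fun i hi => by
    have := hx i hi.ne
    rwa [if_pos hi, hHsymm] at this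
  have hx2 : ∀ i, j < i → inner ℝ (b i) x = 0 := fun i hi => by
    have := hx i hi.ne'
    rwa [if_neg hi.not_gt] at this
  have hxpos : 0 < ‖x‖ ^ 2 := by positivity
  have h1 : lo * ‖x‖ ^ 2 ≤ inner ℝ x ((specOp b σ + δ • outerOp l) x) := by
    have : lo * ‖x‖ ^ 2 ≤ inner ℝ x (specOp b σ x) := by
      rw [inner_specOp, norm_sq_eq_sum_inner b x, Finset.mul_sum]
      refine Finset.sum_le_sum fun i _ => ?_
      rcases le_or_gt i j with h | h
      · have := hlo i (lt_of_le_of_lt h hj)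
        rw [mul_assoc, ← sq]
        gcongr
      · rw [hx2 i h]; simp
    rw [add_apply, smul_apply, inner_add_right, inner_smul_right, inner_outerOp]
    have := mul_nonneg hδ (mul_self_nonneg (inner ℝ l x))
    linarith
  have h2 : inner ℝ x ((specOp b σ + δ • outerOp l) x) ≤ σ' j * (4 * ‖x‖ ^ 2) := by
    have hHx : ‖H x‖ ≤ 2 * ‖x‖ := H.le_of_opNorm_le hH2 x
    calc inner ℝ x ((specOp b σ + δ • outerOp l) x) = inner ℝ (H x) (specOp b' σ' (H x)) := by
          rw [← hM, hHsymm]; rfl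
      _ ≤ σ' j * ‖H x‖ ^ 2 := by
          rw [inner_specOp, norm_sq_eq_sum_inner b', Finset.mul_sum]
          refine Finset.sum_le_sum fun i _ => ?_
          rcases lt_or_ge i j with h | h
          · rw [hx1 i h]; simp
          · rw [mul_assoc, ← sq]
            have := hσ'anti h
            gcongr
      _ ≤ σ' j * (2 * ‖x‖) ^ 2 := by
          have := hσ'0 j
          gcongr
      _ = _ := by ring
  have : lo * ‖x‖ ^ 2 ≤ (4 * σ' j) * ‖x‖ ^ 2 := by linarith
  linarith [le_of_mul_le_mul_right this hxpos]

/-- Effect of a rank-one update and a congruence on the spectral truncation. -/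
theorem norm_truncation_sub_le (hδ : 0 ≤ δ) (hσ'anti : Antitone σ') (hσ'0 : ∀ j, 0 ≤ σ' j)
    (hσ0 : ∀ j, 0 ≤ σ j) (hl : l ∈ Submodule.span ℝ (b '' {j | j.val < k}))
    (hHsymm : ∀ x y, inner ℝ (H x) y = inner ℝ x (H y))
    (hSsymm : ∀ x y, inner ℝ (S x) y = inner ℝ x (S y))
    (hHS : H * S = 1) (hSH : S * H = 1) (hS1 : ‖S‖ ≤ 1) (hH2 : ‖H‖ ≤ 2)
    (hSS : ‖1 - S * S‖ ≤ δ)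
    (hM : H * specOp b' σ' * H = specOp b σ + δ • outerOp l)
    (hlo0 : 0 < lo) (hlo : ∀ j : Fin N, j.val < k → lo ≤ σ j)
    (hhi0 : 0 ≤ hi) (hhi : ∀ j : Fin N, k ≤ j.val → σ j ≤ hi) (hgap : 16 * hi ≤ lo) :
    ‖H * specOp b' (fun j => if j.val < k then σ' j else 0) * H
        - (specOp b (fun j => if j.val < k then σ j else 0) + δ • outerOp l)‖
      ≤ 8 * δ * hi + 16 * (hi / lo) * δ *
        (‖specOp b (fun j => if j.val < k then σ j else 0) + δ • outerOp l‖ + 5 * hi) := by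
  have hM' : specOp b' σ' = S * (specOp b σ + δ • outerOp l) * S := by
    calc specOp b' σ' = (S * H) * specOp b' σ' * (H * S) := by rw [hHS, hSH]; simp
      _ = S * (H * specOp b' σ' * H) * S := by noncomm_ring
      _ = _ := by rw [hM]
  have hup := singVal_congr_le hσ'anti hl hSsymm hS1 hM' hhi0 hhi
  have hlow := le_singVal_congr hδ hσ'anti hσ'0 hHsymm hH2 hM hlo
  have hPP : specOp b (fun j => if j.val < k then (1 : ℝ) else 0)
      * specOp b (fun j => if j.val < k then (1 : ℝ) else 0)
      = specOp b (fun j => if j.val < k then (1 : ℝ) else 0) := by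
    rw [specOp_mul]
    congr 1; ext j; split_ifs <;> simp
  -- The vector `l - P l` is orthogonal to `l` and to `P l`, hence to itself.
  have hPl : specOp b (fun j => if j.val < k then (1 : ℝ) else 0) l = l := by
    have h0 : inner ℝ l (l - specOp b (fun j => if j.val < k then (1 : ℝ) else 0) l) = 0 :=
      inner_eq_zero_of_mem_span hl fun j hj => by
        rw [inner_sub_right, inner_basis_specOp, if_pos hj]; ring
    have h1 : inner ℝ (specOp b (fun j => if j.val < k then (1 : ℝ) else 0) l)
        (l - specOp b (fun j => if j.val < k then (1 : ℝ) else 0) l) = 0 := by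
      rw [specOp_symm, map_sub, ← mul_apply_eq_comp, hPP, sub_self, inner_zero_right]
    have h2 := inner_self_eq_zero (𝕜 := ℝ)
      (x := l - specOp b (fun j => if j.val < k then (1 : ℝ) else 0) l)
    rw [inner_sub_left, h0, h1, sub_self] at h2
    exact (sub_eq_zero.1 (h2.1 rfl)).symm
  have hPll : specOp b (fun j => if j.val < k then (1 : ℝ) else 0) * outerOp l = outerOp l := by
    ext1 x
    rw [mul_apply_eq_comp, outerOp_apply, map_smul, hPl]
  have hllP : outerOp l * specOp b (fun j => if j.val < k then (1 : ℝ) else 0) = outerOp l := by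
    ext1 x
    rw [mul_apply_eq_comp, outerOp_apply, outerOp_apply, ← specOp_symm, hPl]
  refine norm_congr_sub_le (P := specOp b (fun j => if j.val < k then 1 else 0))
    (Q := specOp b (fun j => if j.val < k then 0 else 1))
    (C := specOp b (fun j => if j.val < k then 0 else σ j)) (S := S)
    (Y := specOp b' (fun j => if j.val < k then 0 else σ' j))
    (X' := specOp b' (fun j => if j.val < k then (σ' j)⁻¹ else 0))
    hlo0 hhi0 hgap hδ ?_ ?_ ?_ ?_ hHS hSH ?_ ?_ ?_ ?_ ?_ ?_ ?_ ?_ ?_ hS1 hH2 hSS ?_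
  · rw [specOp_add, ← specOp_one b]
    congr 1; ext j; split_ifs <;> simp
  · rw [mul_add, mul_smul_comm, hPll, specOp_mul]
    congr 2; ext j; split_ifs <;> simp
  · rw [specOp_mul, ← specOp_zero b]
    congr 1; ext j; split_ifs <;> simp
  · rw [specOp_mul]
    congr 1; ext j; split_ifs <;> simp
  · rw [specOp_mul, ← specOp_zero b']
    congr 1; ext j; split_ifs <;> simp
  · rw [specOp_mul, ← specOp_zero b']
    congr 1; ext j; split_ifs <;> simp
  · rw [specOp_mul, specOp_mul]
    congr 1; ext j
    split_ifs with h
    · have : 0 < σ' j := lt_of_lt_of_le (by positivity) (hlow j h)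
      field_simp
    · simp
  · have h1 : specOp b' (fun j => if j.val < k then σ' j else 0)
        + specOp b' (fun j => if j.val < k then 0 else σ' j) = specOp b' σ' := by
      rw [specOp_add]
      congr 1; ext j; split_ifs <;> simp
    have h2 : specOp b (fun j => if j.val < k then σ j else 0)
        + specOp b (fun j => if j.val < k then 0 else σ j) = specOp b σ := by
      rw [specOp_add]
      congr 1; ext j; split_ifs <;> simp
    rw [h1, hM, ← h2]
    abel
  · exact norm_specOp_le _ _ zero_le_one fun j => by split_ifs <;> simp
  · exact norm_specOp_le _ _ zero_le_one fun j => by split_ifs <;> simp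
  · refine norm_specOp_le _ _ hhi0 fun j => ?_
    split_ifs with h
    · simpa using hhi0
    · rw [abs_of_nonneg (hσ0 j)]; exact hhi j (not_lt.1 h)
  · refine norm_specOp_le _ _ hhi0 fun j => ?_
    split_ifs with h
    · simpa using hhi0
    · rw [abs_of_nonneg (hσ'0 j)]; exact hup j (not_lt.1 h)
  · refine norm_specOp_le _ _ (by positivity) fun j => ?_
    split_ifs with h
    · rw [abs_of_nonneg (inv_nonneg.2 (hσ'0 j)), ← inv_div]
      exact inv_anti₀ (by positivity) (hlow j h)
    · rw [abs_zero]; positivity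
  -- Coercivity of the block: for `p = P x`, `lo ‖p‖² ≤ ⟪p, B p⟫ ≤ ‖p‖ ‖B p‖`, the rank-one term
  -- being nonnegative, and `B x = B p`.
  · intro K
    have hpt : ∀ x, lo * ‖specOp b (fun j => if j.val < k then (1 : ℝ) else 0) x‖ ≤
        ‖(specOp b (fun j => if j.val < k then σ j else 0) + δ • outerOp l) x‖ := by
      intro x
      set p := specOp b (fun j => if j.val < k then (1 : ℝ) else 0) x with hp
      have hBp : (specOp b (fun j => if j.val < k then σ j else 0) + δ • outerOp l) x
          = (specOp b (fun j => if j.val < k then σ j else 0) + δ • outerOp l) p := by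
        rw [hp, ← mul_apply_eq_comp, add_mul, smul_mul_assoc, hllP, specOp_mul]
        congr 3; ext j; split_ifs <;> simp
      rw [hBp]
      have hq : lo * ‖p‖ ^ 2 ≤ ‖p‖ *
          ‖(specOp b (fun j => if j.val < k then σ j else 0) + δ • outerOp l) p‖ := by
        refine le_trans ?_ (real_inner_le_norm _ _)
        rw [add_apply, smul_apply, inner_add_right, inner_smul_right, inner_outerOp, inner_specOp,
          norm_sq_eq_sum_inner b p, Finset.mul_sum]
        have h0 := mul_nonneg hδ (mul_self_nonneg (inner ℝ l p))
        refine le_add_of_le_of_nonneg (Finset.sum_le_sum fun i _ => ?_) h0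
        rw [mul_assoc, ← sq]
        split_ifs with h
        · have := hlo i h
          gcongr
        · rw [hp, inner_basis_specOp, if_neg h]; simp
      rcases eq_or_ne ‖p‖ 0 with h | h
      · rw [h]; simp
      · have : 0 < ‖p‖ := lt_of_le_of_ne (norm_nonneg _) (Ne.symm h)
        refine le_of_mul_le_mul_left ?_ this
        linarith [hq, sq ‖p‖]
    rw [← le_div_iff₀' hlo0]
    refine ContinuousLinearMap.opNorm_le_bound _ (by positivity) fun x => ?_
    rw [div_mul_eq_mul_div, le_div_iff₀' hlo0]
    exact (hpt (K x)).trans (ContinuousLinearMap.le_opNorm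
      ((specOp b (fun j => if j.val < k then σ j else 0) + δ • outerOp l) * K) x)

end Truncation

/-! ### First-order expansion of the Gram matrix of the features -/

section Gram

variable {N : ℕ}

lemma exists_orthonormalBasis_eq {v : Fin N → EuclideanSpace ℝ (Fin N)} (hv : Orthonormal ℝ v) :
    ∃ b : OrthonormalBasis (Fin N) ℝ (EuclideanSpace ℝ (Fin N)), ⇑b = v := by
  refine ⟨OrthonormalBasis.mk hv ?_, OrthonormalBasis.coe_mk hv _⟩
  rw [hv.linearIndependent.span_eq_top_of_card_eq_finrank' (by simp)]

lemma inner_basisFun_specOp (b : OrthonormalBasis (Fin N) ℝ (EuclideanSpace ℝ (Fin N)))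
    (σ : Fin N → ℝ) (x y : Fin N) :
    inner ℝ (EuclideanSpace.basisFun (Fin N) ℝ x)
      (specOp b σ (EuclideanSpace.basisFun (Fin N) ℝ y)) = ∑ j, σ j * b j x * b j y := by
  rw [inner_specOp]
  refine Finset.sum_congr rfl fun j _ => ?_
  rw [real_inner_comm, real_inner_comm (EuclideanSpace.basisFun (Fin N) ℝ y),
    EuclideanSpace.basisFun_inner, EuclideanSpace.basisFun_inner]

lemma inner_basisFun_outerOp (l : EuclideanSpace ℝ (Fin N)) (x y : Fin N) :
    inner ℝ (EuclideanSpace.basisFun (Fin N) ℝ x)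
      (outerOp l (EuclideanSpace.basisFun (Fin N) ℝ y)) = l x * l y := by
  rw [inner_outerOp, real_inner_comm, real_inner_comm (EuclideanSpace.basisFun (Fin N) ℝ y),
    EuclideanSpace.basisFun_inner, EuclideanSpace.basisFun_inner]

lemma inner_basisFun_diag_mul_diag (d : Fin N → ℝ)
    (A : EuclideanSpace ℝ (Fin N) →L[ℝ] EuclideanSpace ℝ (Fin N)) (x y : Fin N) :
    inner ℝ (EuclideanSpace.basisFun (Fin N) ℝ x)
      ((specOp (EuclideanSpace.basisFun (Fin N) ℝ) d * A
        * specOp (EuclideanSpace.basisFun (Fin N) ℝ) d) (EuclideanSpace.basisFun (Fin N) ℝ y))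
      = d x * inner ℝ (EuclideanSpace.basisFun (Fin N) ℝ x)
        (A (EuclideanSpace.basisFun (Fin N) ℝ y)) * d y := by
  rw [mul_apply_eq_comp, mul_apply_eq_comp, specOp_basis, map_smul, inner_basis_specOp,
    inner_smul_right]
  ring

lemma clm_ext_basisFun {A A' : EuclideanSpace ℝ (Fin N) →L[ℝ] EuclideanSpace ℝ (Fin N)}
    (h : ∀ x y, inner ℝ (EuclideanSpace.basisFun (Fin N) ℝ x)
        (A (EuclideanSpace.basisFun (Fin N) ℝ y))
      = inner ℝ (EuclideanSpace.basisFun (Fin N) ℝ x)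
        (A' (EuclideanSpace.basisFun (Fin N) ℝ y))) : A = A' := by
  refine clm_ext_basis (EuclideanSpace.basisFun (Fin N) ℝ) fun y => ?_
  ext x
  rw [← EuclideanSpace.basisFun_inner, ← EuclideanSpace.basisFun_inner]
  exact h x y

lemma abs_inner_basisFun_le (A : EuclideanSpace ℝ (Fin N) →L[ℝ] EuclideanSpace ℝ (Fin N))
    (x y : Fin N) : |inner ℝ (EuclideanSpace.basisFun (Fin N) ℝ x)
        (A (EuclideanSpace.basisFun (Fin N) ℝ y))| ≤ ‖A‖ := by
  have h := (abs_real_inner_le_norm (EuclideanSpace.basisFun (Fin N) ℝ x)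
    (A (EuclideanSpace.basisFun (Fin N) ℝ y)))
  have h2 := A.le_opNorm (EuclideanSpace.basisFun (Fin N) ℝ y)
  rw [(EuclideanSpace.basisFun (Fin N) ℝ).orthonormal.1] at h h2
  linarith

lemma sum_filter_mul_eq {k : ℕ} (σ : Fin N → ℝ) (v : Fin N → EuclideanSpace ℝ (Fin N))
    (x y : Fin N) : ∑ j with j.val < k, σ j * v j x * v j y
      = ∑ j, (if j.val < k then σ j else 0) * v j x * v j y := by
  rw [Finset.sum_filter]
  exact Finset.sum_congr rfl fun j _ => by split_ifs <;> simp

lemma normAdj_of_deg_one {A : Matrix (Fin N) (Fin N) ℝ} (h : ∀ x, deg A x = 1) :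
    normAdj A = A := by
  ext x y
  simp [normAdj, h]

/-- The singular values of a stochastic matrix are bounded by its size. -/
lemma IsSVD.le_card {A : Matrix (Fin N) (Fin N) ℝ} (hA0 : ∀ x y, 0 ≤ A x y)
    (hA1 : ∀ x, deg A x = 1) {σ : Fin N → ℝ} {v : Fin N → EuclideanSpace ℝ (Fin N)}
    (h : IsSVD A σ v) (j : Fin N) : σ j ≤ N := by
  -- A nonnegative singular value is at most the trace, whose diagonal entries are bounded by the
  -- row sums.
  calc σ j ≤ ∑ i, σ i := Finset.single_le_sum (fun i _ => h.nonneg i) (Finset.mem_univ j)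
    _ = ∑ i, σ i * ‖v i‖ ^ 2 := by simp [h.orthonormal.1]
    _ = ∑ x, A x x := by
      simp_rw [h.eq_sum, EuclideanSpace.real_norm_sq_eq, Finset.mul_sum]
      rw [Finset.sum_comm]
      exact Finset.sum_congr rfl fun x _ => Finset.sum_congr rfl fun i _ => by ring
    _ ≤ ∑ x : Fin N, (1 : ℝ) := by
      refine Finset.sum_le_sum fun x _ => ?_
      rw [← hA1 x]
      exact Finset.single_le_sum (fun y _ => hA0 x y) (Finset.mem_univ x)
    _ = N := by simp

lemma deg_update {A : Matrix (Fin N) (Fin N) ℝ} (hA1 : ∀ x, deg A x = 1) {l : Fin N → ℝ}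
    (hl1 : ∑ x, l x = 1) (δ : ℝ) (x : Fin N) :
    deg (A + δ • Matrix.vecMulVec l l) x = 1 + δ * l x := by
  have := hA1 x
  simp only [deg, Matrix.add_apply, Matrix.smul_apply, Matrix.vecMulVec_apply, smul_eq_mul,
    Finset.sum_add_distrib, ← Finset.mul_sum, hl1, mul_one] at this ⊢
  rw [this]

lemma abs_inv_mul_inv_sub_le {u w : ℝ} (hu : 0 ≤ u) (hw : 0 ≤ w) :
    |(1 + u)⁻¹ * (1 + w)⁻¹ - (1 - u - w)| ≤ (u + w) ^ 2 := by
  have h1 : (1 + u)⁻¹ * (1 + w)⁻¹ - (1 - u - w)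
      = ((u + w) ^ 2 - u * w * (1 - u - w)) / ((1 + u) * (1 + w)) := by
    field_simp
    ring
  have h3 : 0 ≤ u * w := by positivity
  have h4 : 0 ≤ u * w * (u + w) := by positivity
  have h5 : 0 ≤ (u + w) ^ 2 * (u + w + u * w) := by positivity
  have h6 : u * w ≤ (u + w) ^ 2 := by nlinarith
  rw [h1, abs_le, le_div_iff₀ (by positivity), div_le_iff₀ (by positivity)]
  constructor <;> nlinarith

/-- First-order expansion of the entries of a truncated normalized adjacency matrix. -/
lemma abs_expansion_sub_le {n δ ε e Γ p q r : ℝ} (hδ0 : 0 ≤ δ)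
    (hp0 : 0 ≤ p) (hp1 : p ≤ 1) (hq0 : 0 ≤ q) (hq1 : q ≤ 1) (hδ1 : δ ≤ 1) (hΓ : |Γ| ≤ n)
    (he : |r - (Γ + δ * (p * q))| ≤ e) (hee : e ≤ 40 * (n + 1) * (δ * ε)) :
    |(1 + δ * p)⁻¹ * r * (1 + δ * q)⁻¹ - (Γ + δ * (p * q - (p + q) * Γ))|
      ≤ 40 * (n + 1) * (δ * ε + δ ^ 2) := by
  have hn : 0 ≤ n := (abs_nonneg _).trans hΓ
  have hu : 0 ≤ δ * p := by positivity
  have hw : 0 ≤ δ * q := by positivity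
  set g := (1 + δ * p)⁻¹ * (1 + δ * q)⁻¹ with hg
  have hg0 : 0 ≤ g := by positivity
  have hg1 : g ≤ 1 := mul_le_one₀ (inv_le_one_of_one_le₀ (by linarith)) (by positivity)
    (inv_le_one_of_one_le₀ (by linarith))
  have huw : δ * p + δ * q ≤ 2 * δ := by nlinarith
  have hsq : (δ * p + δ * q) ^ 2 ≤ 4 * δ ^ 2 := by nlinarith
  have hg2 : |g - (1 - δ * p - δ * q)| ≤ 4 * δ ^ 2 := (abs_inv_mul_inv_sub_le hu hw).trans hsq
  have hg3 : |g - 1| ≤ 6 * δ := by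
    rw [abs_le] at hg2 ⊢
    constructor <;> nlinarith
  have e1 : (1 + δ * p)⁻¹ * r * (1 + δ * q)⁻¹ - (Γ + δ * (p * q - (p + q) * Γ))
      = (g - (1 - δ * p - δ * q)) * Γ + (g - 1) * (δ * (p * q))
        + g * (r - (Γ + δ * (p * q))) := by rw [hg]; ring
  have hpq : |δ * (p * q)| ≤ δ := by
    rw [abs_of_nonneg (by positivity)]
    nlinarith [mul_le_one₀ hp1 hq0 hq1]
  rw [e1]
  calc _ ≤ |g - (1 - δ * p - δ * q)| * |Γ| + |g - 1| * |δ * (p * q)|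
        + |g| * |r - (Γ + δ * (p * q))| := by
        rw [← abs_mul, ← abs_mul, ← abs_mul]; exact abs_add_three _ _ _
    _ ≤ 4 * δ ^ 2 * n + 6 * δ * δ + 1 * e := by
        rw [abs_of_nonneg hg0]
        gcongr
    _ ≤ _ := by nlinarith [mul_nonneg hn (sq_nonneg δ), sq_nonneg δ]

/-- First-order expansion of the similarities of the features after a rank-one update of the
adjacency matrix. -/
theorem abs_gram_sub_le {k : ℕ} {A : Matrix (Fin N) (Fin N) ℝ} (hA0 : ∀ x y, 0 ≤ A x y)
    (hA1 : ∀ x, deg A x = 1) {l : Fin N → ℝ} (hl0 : ∀ x, 0 ≤ l x) (hl1 : ∑ x, l x = 1)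
    {δ : ℝ} (hδ0 : 0 ≤ δ) (hδ1 : δ ≤ 1)
    {σ σ' : Fin N → ℝ} {v v' : Fin N → EuclideanSpace ℝ (Fin N)}
    {Z Z' : Fin N → EuclideanSpace ℝ (Fin k)}
    (hZ : IsSpectralRep A σ v Z) (hZ' : IsSpectralRep (A + δ • Matrix.vecMulVec l l) σ' v' Z')
    (hl : WithLp.toLp 2 l ∈ Submodule.span ℝ (v '' {j | j.val < k}))
    {lo hi ε : ℝ} (hlo0 : 0 < lo) (hlo : ∀ j : Fin N, j.val < k → lo ≤ σ j) (hloN : lo ≤ N)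
    (hhi0 : 0 ≤ hi) (hhi : ∀ j : Fin N, k ≤ j.val → σ j ≤ hi)
    (hε : hi = lo * ε) (hε16 : 16 * ε ≤ 1) (x y : Fin N) :
    |inner ℝ (Z x) (Z y)| ≤ N ∧
    |inner ℝ (Z' x) (Z' y)
        - (inner ℝ (Z x) (Z y) + δ * (l x * l y - (l x + l y) * inner ℝ (Z x) (Z y)))|
      ≤ 40 * (N + 1) * (δ * ε + δ ^ 2) := by
  have hl1' : ∀ x, l x ≤ 1 := fun x => by
    rw [← hl1]; exact Finset.single_le_sum (fun y _ => hl0 y) (Finset.mem_univ x)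
  have hsvd := hZ.svd
  rw [normAdj_of_deg_one hA1] at hsvd
  have hσN := hsvd.le_card hA0 hA1
  have hdeg := deg_update hA1 hl1 δ
  have hd1 : ∀ x, 1 ≤ 1 + δ * l x := fun x => by have := mul_nonneg hδ0 (hl0 x); linarith
  have hd2 : ∀ x, 1 + δ * l x ≤ 2 := fun x => by
    have := mul_le_one₀ hδ1 (hl0 x) (hl1' x); linarith
  have hs1 : ∀ x, 1 ≤ √(1 + δ * l x) := fun x => Real.one_le_sqrt.2 (hd1 x)
  have hspos : ∀ x, 0 < √(1 + δ * l x) := fun x => one_pos.trans_le (hs1 x)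
  obtain ⟨b, rfl⟩ := exists_orthonormalBasis_eq hsvd.orthonormal
  obtain ⟨b', rfl⟩ := exists_orthonormalBasis_eq hZ'.svd.orthonormal
  have hε0 : 0 ≤ ε := by
    rw [hε] at hhi0
    exact nonneg_of_mul_nonneg_right hhi0 hlo0
  have hB1 : ‖specOp b (fun j => if j.val < k then σ j else 0)‖ ≤ N := by
    refine norm_specOp_le _ _ (Nat.cast_nonneg N) fun j => ?_
    split_ifs
    · rw [abs_of_nonneg (hsvd.nonneg j)]; exact hσN j
    · simp
  have hlnorm : ‖(WithLp.toLp 2 l : EuclideanSpace ℝ (Fin N))‖ ≤ 1 := by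
    rw [← sq_le_one_iff₀ (norm_nonneg _), EuclideanSpace.real_norm_sq_eq, ← hl1]
    exact Finset.sum_le_sum fun x _ => by
      simpa [sq] using mul_le_of_le_one_right (hl0 x) (hl1' x)
  have hB2 : ‖specOp b (fun j => if j.val < k then σ j else 0)
      + δ • outerOp (WithLp.toLp 2 l)‖ ≤ N + 1 := by
    refine (norm_add_le _ _).trans (add_le_add hB1 ?_)
    rw [norm_smul, Real.norm_of_nonneg hδ0]
    exact mul_le_one₀ hδ1 (norm_nonneg _) (norm_outerOp_le hlnorm)
  have hgram : ∀ x y, inner ℝ (Z x) (Z y)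
      = inner ℝ (EuclideanSpace.basisFun (Fin N) ℝ x)
      (specOp b (fun j => if j.val < k then σ j else 0)
        (EuclideanSpace.basisFun (Fin N) ℝ y)) := fun x y => by
    rw [hZ.gram, hA1, hA1, inner_basisFun_specOp, sum_filter_mul_eq]
    simp
  -- `H` and `S` are `D^(1/2)` and `D^(-1/2)`, diagonal in the standard basis. The degrees lie
  -- between `1` and `1 + δ ≤ 2`, whence the three norm bounds.
  have key := norm_truncation_sub_le (k := k) (b := b) (b' := b') (σ := σ) (σ' := σ')
    (H := specOp (EuclideanSpace.basisFun (Fin N) ℝ) (fun x => √(1 + δ * l x)))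
    (S := specOp (EuclideanSpace.basisFun (Fin N) ℝ) (fun x => (√(1 + δ * l x))⁻¹))
    hδ0 hZ'.svd.antitone hZ'.svd.nonneg hsvd.nonneg hl (specOp_symm _ _) (specOp_symm _ _)
    (by rw [specOp_mul, ← specOp_one (EuclideanSpace.basisFun (Fin N) ℝ)]; congr 1; ext x; exact mul_inv_cancel₀ (hspos x).ne')
    (by rw [specOp_mul, ← specOp_one (EuclideanSpace.basisFun (Fin N) ℝ)]; congr 1; ext x; exact inv_mul_cancel₀ (hspos x).ne')
    (norm_specOp_le _ _ zero_le_one fun x => by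
      rw [abs_of_nonneg (inv_nonneg.2 (hspos x).le)]; exact inv_le_one_of_one_le₀ (hs1 x))
    (norm_specOp_le _ _ zero_le_two fun x => by
      rw [abs_of_nonneg (hspos x).le]
      exact Real.sqrt_le_iff.2 ⟨by norm_num, by linarith [hd2 x]⟩)
    (by
      rw [specOp_mul, one_sub_specOp]
      refine norm_specOp_le _ _ hδ0 fun x => ?_
      have h0 := hd1 x
      rw [← mul_inv, Real.mul_self_sqrt (by linarith)]
      have h1 : 1 - (1 + δ * l x)⁻¹ = δ * l x * (1 + δ * l x)⁻¹ := by field_simp; ring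
      have h2 : 0 ≤ δ * l x := mul_nonneg hδ0 (hl0 x)
      rw [h1, abs_of_nonneg (by positivity)]
      calc δ * l x * (1 + δ * l x)⁻¹ ≤ δ * 1 * 1 := by
            gcongr
            · exact hl1' x
            · exact inv_le_one_of_one_le₀ h0
        _ = δ := by ring)
    (by
      refine clm_ext_basisFun fun x y => ?_
      rw [inner_basisFun_diag_mul_diag, add_apply, smul_apply, inner_add_right, inner_smul_right,
        inner_basisFun_outerOp, inner_basisFun_specOp, inner_basisFun_specOp, ← hsvd.eq_sum,
        ← hZ'.svd.eq_sum]
      have h1 := (hspos x).ne'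
      have h2 := (hspos y).ne'
      simp only [normAdj, hdeg, Matrix.add_apply, Matrix.smul_apply, Matrix.vecMulVec_apply,
        smul_eq_mul]
      field_simp)
    hlo0 hlo hhi0 hhi (by rw [hε]; nlinarith)
  refine ⟨by rw [hgram]; exact (abs_inner_basisFun_le _ x y).trans hB1, ?_⟩
  have hent := (abs_inner_basisFun_le _ x y).trans key
  rw [sub_apply, inner_sub_right, inner_basisFun_diag_mul_diag, add_apply, smul_apply,
    inner_add_right, inner_smul_right, inner_basisFun_outerOp, ← hgram, inner_basisFun_specOp]
    at hent
  -- This is `S X S = S² (H X H) S²` entrywise; `S²` has diagonal entries `(1 + δ l)⁻¹`, free of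
  -- square roots.
  have hgram' : inner ℝ (Z' x) (Z' y) = (1 + δ * l x)⁻¹ *
      (√(1 + δ * l x) * (∑ j, (if j.val < k then σ' j else 0) * b' j x * b' j y)
        * √(1 + δ * l y)) * (1 + δ * l y)⁻¹ := by
    rw [hZ'.gram, hdeg, hdeg, sum_filter_mul_eq]
    have h1 := (hspos x).ne'
    have h2 := (hspos y).ne'
    have h3 : 1 + δ * l x = √(1 + δ * l x) ^ 2 := (Real.sq_sqrt (by linarith [hd1 x])).symm
    have h4 : 1 + δ * l y = √(1 + δ * l y) ^ 2 := (Real.sq_sqrt (by linarith [hd1 y])).symm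
    generalize √(1 + δ * l x) = p at *
    generalize √(1 + δ * l y) = q at *
    rw [h3, h4]
    field_simp
  rw [hgram']
  refine abs_expansion_sub_le hδ0 (hl0 x) (hl1' x) (hl0 y) (hl1' y) hδ1 ?_ hent ?_
  · rw [hgram]; exact (abs_inner_basisFun_le _ x y).trans hB1
  · have h1 : hi / lo = ε := by rw [hε]; field_simp
    rw [h1]
    have h2 : hi ≤ N * ε := by rw [hε]; gcongr
    have hN0 : (0 : ℝ) ≤ N := Nat.cast_nonneg N
    have h3 : hi ≤ N / 16 := by nlinarith
    have hδε : 0 ≤ δ * ε := by positivity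
    calc _ ≤ 8 * δ * (N * ε) + 16 * ε * δ * ((N + 1) + 5 * (N / 16)) := by gcongr
      _ = (8 * N + 16 * (N + 1) + 5 * N) * (δ * ε) := by ring
      _ ≤ _ := by
        refine mul_le_mul_of_nonneg_right ?_ hδε
        linarith

end Gram

/-! ### The K-means measure as a function of the similarities -/

section Scatter

variable {N k : ℕ}

/-- Sum of the entries of `Γ` over a rectangle. -/
def blockSum (Γ : Fin N → Fin N → ℝ) (s t : Finset (Fin N)) : ℝ := ∑ i ∈ s, ∑ j ∈ t, Γ i j

/-- Scatter of one class in terms of the similarities. -/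
noncomputable def scatter (Γ : Fin N → Fin N → ℝ) (c : Finset (Fin N)) : ℝ :=
  ∑ i ∈ c, Γ i i - (c.card : ℝ)⁻¹ * blockSum Γ c c

/-- Intra-class scatter in terms of the similarities. -/
noncomputable def intraSim (Q : Finpartition (Finset.univ : Finset (Fin N)))
    (Γ : Fin N → Fin N → ℝ) : ℝ := ∑ c ∈ Q.parts, scatter Γ c

/-- Inter-class scatter in terms of the similarities. -/
noncomputable def interSim (Q : Finpartition (Finset.univ : Finset (Fin N)))
    (Γ : Fin N → Fin N → ℝ) : ℝ :=
  ∑ c ∈ Q.parts, (c.card : ℝ)⁻¹ * blockSum Γ c c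
    - (N : ℝ)⁻¹ * blockSum Γ Finset.univ Finset.univ

variable (Q : Finpartition (Finset.univ : Finset (Fin N)))
  (Z : Fin N → EuclideanSpace ℝ (Fin k))

lemma sum_parts_sum {M : Type*} [AddCommMonoid M] (f : Fin N → M) :
    ∑ c ∈ Q.parts, ∑ i ∈ c, f i = ∑ i, f i := by
  conv_rhs => rw [← Q.biUnion_parts]
  exact (Finset.sum_biUnion Q.disjoint).symm

lemma sum_card_parts_real : ∑ c ∈ Q.parts, (c.card : ℝ) = N := by
  have := sum_parts_sum Q (fun _ => (1 : ℝ))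
  simpa using this

lemma card_smul_center (c : Finset (Fin N)) : (c.card : ℝ) • center Z c = ∑ i ∈ c, Z i := by
  rcases c.eq_empty_or_nonempty with rfl | hc
  · simp
  · have : (c.card : ℝ) ≠ 0 := by exact_mod_cast hc.card_ne_zero
    rw [center, smul_smul, mul_inv_cancel₀ this, one_smul]

lemma blockSum_inner (s t : Finset (Fin N)) :
    blockSum (fun i j => inner ℝ (Z i) (Z j)) s t = inner ℝ (∑ i ∈ s, Z i) (∑ j ∈ t, Z j) := by
  rw [blockSum, sum_inner]
  simp [inner_sum]

lemma inv_card_mul_blockSum (c : Finset (Fin N)) :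
    (c.card : ℝ)⁻¹ * blockSum (fun i j => inner ℝ (Z i) (Z j)) c c
      = c.card * ‖center Z c‖ ^ 2 := by
  rcases c.eq_empty_or_nonempty with rfl | hc
  · simp
  · have : (c.card : ℝ) ≠ 0 := by exact_mod_cast hc.card_ne_zero
    rw [blockSum_inner, ← card_smul_center, real_inner_self_eq_norm_sq, norm_smul, mul_pow,
      Real.norm_eq_abs, sq_abs]
    field_simp

lemma sum_norm_sub_center_sq (c : Finset (Fin N)) :
    ∑ i ∈ c, ‖Z i - center Z c‖ ^ 2 = scatter (fun i j => inner ℝ (Z i) (Z j)) c := by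
  rw [scatter, inv_card_mul_blockSum]
  simp_rw [norm_sub_sq_real, Finset.sum_add_distrib, Finset.sum_sub_distrib, ← Finset.mul_sum,
    ← sum_inner, ← card_smul_center, real_inner_smul_left, real_inner_self_eq_norm_sq]
  simp only [Finset.sum_const, nsmul_eq_mul]
  ring

lemma intraClass_eq : intraClass Q Z = intraSim Q (fun i j => inner ℝ (Z i) (Z j)) :=
  Finset.sum_congr rfl fun c _ => sum_norm_sub_center_sq Z c

/-- After expanding the squares, the cross terms collapse because the class centers weighted by
class size add up to `N` times the global center. -/
lemma interClass_eq : interClass Q Z = interSim Q (fun i j => inner ℝ (Z i) (Z j)) := by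
  have h1 := inv_card_mul_blockSum Z Finset.univ
  rw [Finset.card_univ, Fintype.card_fin] at h1
  have h2 : ∑ c ∈ Q.parts, (c.card : ℝ) • center Z c = (N : ℝ) • center Z Finset.univ := by
    have := card_smul_center Z Finset.univ
    rw [Finset.card_univ, Fintype.card_fin] at this
    simp_rw [card_smul_center]
    rw [sum_parts_sum, this]
  rw [interSim, interClass, h1]
  simp_rw [inv_card_mul_blockSum, norm_sub_sq_real, mul_add, mul_sub, Finset.sum_add_distrib,
    Finset.sum_sub_distrib]
  have h3 : ∑ c ∈ Q.parts, (c.card : ℝ) * (2 * inner ℝ (center Z c) (center Z Finset.univ))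
      = 2 * (N * ‖center Z Finset.univ‖ ^ 2) := by
    rw [← real_inner_self_eq_norm_sq, ← real_inner_smul_left, ← h2, sum_inner, Finset.mul_sum]
    refine Finset.sum_congr rfl fun c _ => ?_
    rw [real_inner_smul_left]; ring
  rw [h3, ← Finset.sum_mul, sum_card_parts_real]
  ring

lemma blockSum_linear (Γ Γ' : Fin N → Fin N → ℝ) (a : ℝ) (s t : Finset (Fin N)) :
    blockSum (fun i j => Γ i j + a * Γ' i j) s t = blockSum Γ s t + a * blockSum Γ' s t := by
  simp [blockSum, Finset.sum_add_distrib, Finset.mul_sum]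

lemma intraSim_linear (Γ Γ' : Fin N → Fin N → ℝ) (a : ℝ) :
    intraSim Q (fun i j => Γ i j + a * Γ' i j) = intraSim Q Γ + a * intraSim Q Γ' := by
  simp only [intraSim, scatter, blockSum_linear, Finset.mul_sum]
  rw [← Finset.sum_add_distrib]
  refine Finset.sum_congr rfl fun c _ => ?_
  rw [Finset.sum_add_distrib, ← Finset.mul_sum]
  ring

lemma interSim_linear (Γ Γ' : Fin N → Fin N → ℝ) (a : ℝ) :
    interSim Q (fun i j => Γ i j + a * Γ' i j) = interSim Q Γ + a * interSim Q Γ' := by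
  simp only [interSim, blockSum_linear, mul_add, mul_sub, Finset.mul_sum,
    Finset.sum_add_distrib]
  have : ∀ c : Finset (Fin N), (c.card : ℝ)⁻¹ * (a * blockSum Γ' c c)
      = a * ((c.card : ℝ)⁻¹ * blockSum Γ' c c) := fun c => by ring
  simp only [this]
  ring

variable {Q}

lemma abs_blockSum_le {Γ : Fin N → Fin N → ℝ} {e : ℝ} (h : ∀ i j, |Γ i j| ≤ e)
    (s : Finset (Fin N)) : |(s.card : ℝ)⁻¹ * blockSum Γ s s| ≤ s.card * e := by
  rcases s.eq_empty_or_nonempty with rfl | hs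
  · simp
  have hpos : (0 : ℝ) < s.card := by exact_mod_cast hs.card_pos
  have h1 : |blockSum Γ s s| ≤ s.card * (s.card * e) := by
    calc |blockSum Γ s s| ≤ ∑ i ∈ s, |∑ j ∈ s, Γ i j| := Finset.abs_sum_le_sum_abs _ _
      _ ≤ ∑ i ∈ s, ∑ j ∈ s, |Γ i j| := Finset.sum_le_sum fun i _ => Finset.abs_sum_le_sum_abs _ _
      _ ≤ ∑ i ∈ s, ∑ j ∈ s, e := Finset.sum_le_sum fun i _ => Finset.sum_le_sum fun j _ => h i j
      _ = _ := by simp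
  rw [abs_mul, abs_of_pos (inv_pos.2 hpos), inv_mul_le_iff₀ hpos]
  exact h1

/-- Each class contributes at most `2 e` per vertex and the class sizes add up to `N`, so the bound
does not depend on the partition. -/
lemma abs_intraSim_le {Γ : Fin N → Fin N → ℝ} {e : ℝ} (h : ∀ i j, |Γ i j| ≤ e) :
    |intraSim Q Γ| ≤ 2 * N * e := by
  calc |intraSim Q Γ| ≤ ∑ c ∈ Q.parts, |scatter Γ c| := Finset.abs_sum_le_sum_abs _ _
    _ ≤ ∑ c ∈ Q.parts, (c.card : ℝ) * (2 * e) := Finset.sum_le_sum fun c _ => by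
        have h1 : |∑ i ∈ c, Γ i i| ≤ c.card * e :=
          (Finset.abs_sum_le_sum_abs _ _).trans
            ((Finset.sum_le_sum fun i _ => h i i).trans_eq (by simp))
        calc |scatter Γ c| ≤ |∑ i ∈ c, Γ i i| + |(c.card : ℝ)⁻¹ * blockSum Γ c c| := abs_sub _ _
          _ ≤ c.card * e + c.card * e := add_le_add h1 (abs_blockSum_le h c)
          _ = _ := by ring
    _ = _ := by rw [← Finset.sum_mul, sum_card_parts_real]; ring

lemma abs_interSim_le {Γ : Fin N → Fin N → ℝ} {e : ℝ} (h : ∀ i j, |Γ i j| ≤ e) :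
    |interSim Q Γ| ≤ 2 * N * e := by
  have h1 := abs_blockSum_le h Finset.univ
  rw [Finset.card_univ, Fintype.card_fin] at h1
  have h2 : |∑ c ∈ Q.parts, (c.card : ℝ)⁻¹ * blockSum Γ c c| ≤ N * e := by
    calc _ ≤ ∑ c ∈ Q.parts, |(c.card : ℝ)⁻¹ * blockSum Γ c c| := Finset.abs_sum_le_sum_abs _ _
      _ ≤ ∑ c ∈ Q.parts, (c.card : ℝ) * e := Finset.sum_le_sum fun c _ => abs_blockSum_le h c
      _ = _ := by rw [← Finset.sum_mul, sum_card_parts_real]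
  calc |interSim Q Γ| ≤ _ := abs_sub _ _
    _ ≤ N * e + N * e := add_le_add h2 h1
    _ = _ := by ring

variable {Γ : Fin N → Fin N → ℝ} {l : Fin N → ℝ} {lc : Finset (Fin N) → ℝ}

/-- First-order change of the similarities when the labels are added. -/
def simPert (Γ : Fin N → Fin N → ℝ) (l : Fin N → ℝ) (i j : Fin N) : ℝ :=
  l i * l j - (l i + l j) * Γ i j

lemma blockSum_simPert_self {c : Finset (Fin N)} (hc : ∀ i ∈ c, l i = lc c) :
    blockSum (simPert Γ l) c c = (c.card : ℝ) ^ 2 * lc c ^ 2 - 2 * lc c * blockSum Γ c c := by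
  have : blockSum (simPert Γ l) c c = ∑ i ∈ c, ∑ j ∈ c, (lc c ^ 2 - 2 * lc c * Γ i j) :=
    Finset.sum_congr rfl fun i hi => Finset.sum_congr rfl fun j hj => by
      rw [simPert, hc i hi, hc j hj]; ring
  rw [this]
  simp only [Finset.sum_sub_distrib, Finset.sum_const, nsmul_eq_mul, ← Finset.mul_sum]
  rw [blockSum]
  ring

/-- Within a class the term `l i * l j` is constant, and a constant similarity has zero scatter;
what remains is `-2 * lc c` times `Γ`. -/
lemma intraSim_simPert (hlc : ∀ c ∈ Q.parts, ∀ i ∈ c, l i = lc c) :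
    intraSim Q (simPert Γ l) = - (2 * ∑ c ∈ Q.parts, lc c * scatter Γ c) := by
  rw [intraSim, Finset.mul_sum, ← Finset.sum_neg_distrib]
  refine Finset.sum_congr rfl fun c hc => ?_
  have hpos : (c.card : ℝ) ≠ 0 := by exact_mod_cast (Q.nonempty_of_mem_parts hc).card_ne_zero
  rw [scatter, scatter, blockSum_simPert_self (hlc c hc)]
  have : ∑ i ∈ c, simPert Γ l i i = ∑ i ∈ c, (lc c ^ 2 - 2 * lc c * Γ i i) :=
    Finset.sum_congr rfl fun i hi => by rw [simPert, hlc c hc i hi]; ring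
  rw [this, Finset.sum_sub_distrib, ← Finset.mul_sum, Finset.sum_const, nsmul_eq_mul]
  field_simp
  ring

lemma blockSum_simPert_univ (hΓ : ∀ i j, Γ i j = Γ j i) (hl1 : ∑ i, l i = 1)
    (hlc : ∀ c ∈ Q.parts, ∀ i ∈ c, l i = lc c) :
    blockSum (simPert Γ l) Finset.univ Finset.univ
      = 1 - 2 * ∑ c ∈ Q.parts, lc c * blockSum Γ c Finset.univ := by
  have h1 : ∑ c ∈ Q.parts, lc c * blockSum Γ c Finset.univ = ∑ i, ∑ j, l i * Γ i j := by
    rw [← sum_parts_sum Q]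
    refine Finset.sum_congr rfl fun c hc => ?_
    rw [blockSum, Finset.mul_sum]
    refine Finset.sum_congr rfl fun i hi => ?_
    rw [hlc c hc i hi, Finset.mul_sum]
  have h2 : ∑ i, ∑ j, l j * Γ i j = ∑ i, ∑ j, l i * Γ i j := by
    rw [Finset.sum_comm]
    exact Finset.sum_congr rfl fun i _ => Finset.sum_congr rfl fun j _ => by rw [hΓ]
  have h3 : ∑ i, ∑ j, l i * l j = 1 := by
    rw [← Finset.sum_mul_sum, hl1, one_mul]
  simp only [blockSum, simPert, add_mul, Finset.sum_sub_distrib, Finset.sum_add_distrib]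
  rw [h3, h2, ← h1]
  simp only [blockSum]
  ring

/-- The mean similarity of `c` to all vertices mixes those to `c` and to `cᶜ` with weights `|c| / N`
and `1 - |c| / N`. The factor `1 - |c| / N` thus turns the difference to `cᶜ` into the difference to
the whole set. -/
lemma card_mul_selfClusterability {c : Finset (Fin N)} (hc : c.Nonempty) :
    (c.card : ℝ) * selfClusterability Z c
      = 2 * ((c.card : ℝ)⁻¹ * blockSum (fun i j => inner ℝ (Z i) (Z j)) c c
        - (N : ℝ)⁻¹ * blockSum (fun i j => inner ℝ (Z i) (Z j)) c Finset.univ) := by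
  have hpos : (c.card : ℝ) ≠ 0 := by exact_mod_cast hc.card_ne_zero
  have hN : (N : ℝ) ≠ 0 := by
    obtain ⟨i, _⟩ := hc
    exact_mod_cast i.pos.ne'
  have hmean : ∀ s t : Finset (Fin N), meanSim Z s t
      = (s.card : ℝ)⁻¹ * (t.card : ℝ)⁻¹ * blockSum (fun i j => inner ℝ (Z i) (Z j)) s t := by
    intro s t
    simp only [meanSim, blockSum, Finset.mul_sum, mul_assoc]
  have hsplit : blockSum (fun i j => inner ℝ (Z i) (Z j)) c Finset.univ
      = blockSum (fun i j => inner ℝ (Z i) (Z j)) c c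
        + blockSum (fun i j => inner ℝ (Z i) (Z j)) c cᶜ := by
    simp only [blockSum, ← Finset.sum_add_distrib, Finset.sum_add_sum_compl]
  rw [selfClusterability, hmean, hmean, hsplit]
  -- For the whole set the mean over the empty complement has the default value `0`, but the
  -- prefactor vanishes, and so does the right side.
  rcases eq_or_ne c Finset.univ with rfl | hne
  · simp [blockSum]
    field_simp
    simp
  · have hcc : ((cᶜ).card : ℝ) = N - c.card := by
      rw [Finset.card_compl, Fintype.card_fin,
        Nat.cast_sub (by simpa using Finset.card_le_univ c)]
    have hne' : (N : ℝ) - c.card ≠ 0 := by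
      rw [← hcc]
      exact_mod_cast Finset.card_ne_zero.2
        (Finset.nonempty_iff_ne_empty.2 (by simpa using hne))
    rw [hcc]
    field_simp
    ring

lemma interSim_simPert (hl1 : ∑ i, l i = 1) (hlc : ∀ c ∈ Q.parts, ∀ i ∈ c, l i = lc c) :
    interSim Q (simPert (fun i j => inner ℝ (Z i) (Z j)) l)
      = ∑ c ∈ Q.parts, (c.card : ℝ) * lc c * classPert Z (lc c) c := by
  have h1 : ∑ c ∈ Q.parts, (c.card : ℝ) * lc c = 1 := by
    rw [← hl1, ← sum_parts_sum Q]
    refine Finset.sum_congr rfl fun c hc => ?_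
    rw [Finset.sum_congr rfl (hlc c hc)]
    simp
  rw [interSim, blockSum_simPert_univ (fun i j => real_inner_comm _ _) hl1 hlc]
  -- The total mass `1` of `l`, distributed over the classes, produces the `-1 / N` in each
  -- `classPert`.
  rw [← h1]
  rw [Finset.mul_sum, ← Finset.sum_sub_distrib, Finset.mul_sum, ← Finset.sum_sub_distrib]
  refine Finset.sum_congr rfl fun c hc => ?_
  have hne := Q.nonempty_of_mem_parts hc
  have hpos : (c.card : ℝ) ≠ 0 := by exact_mod_cast hne.card_ne_zero
  have h2 := card_mul_selfClusterability Z hne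
  rw [blockSum_simPert_self (hlc c hc)]
  have h3 : (c.card : ℝ) * lc c * classPert Z (lc c) c
      = (c.card : ℝ) * lc c * (lc c - 1 / N) - lc c * (c.card * selfClusterability Z c) := by
    rw [classPert]; ring
  rw [h3, h2]
  field_simp
  ring

/-- First-order expansion of a quotient. -/
lemma abs_div_sub_div_sub_le {I J I₁ J₁ I' J' K B δ e : ℝ} (hB : 1 ≤ B) (hδ0 : 0 ≤ δ)
    (hK : 0 ≤ K) (hI : |I| ≤ K) (hI₁ : |I₁| ≤ K) (hJ₁ : |J₁| ≤ K)
    (hJK : |J| ≤ K) (hJ : 1 ≤ B * J) (heI : |I' - (I + δ * I₁)| ≤ e)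
    (heJ : |J' - (J + δ * J₁)| ≤ e) (hsmall : 2 * B * (δ * K + e) ≤ 1) :
    |I / J - I' / J' - δ * (I * J₁ - I₁ * J) / J ^ 2|
      ≤ 2 * B ^ 3 * (δ * (2 * K ^ 2)) * (δ * K + e) + 2 * B ^ 2 * (2 * K * e) := by
  have hB0 : 0 < B := by linarith
  have hJ0 : 0 < J := pos_of_mul_pos_right (by linarith) hB0.le
  have he0 : 0 ≤ e := (abs_nonneg _).trans heI
  have hJJ' : |J - J'| ≤ δ * K + e := by
    have : J - J' = -(δ * J₁) - (J' - (J + δ * J₁)) := by ring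
    rw [this]
    refine (abs_sub _ _).trans (add_le_add ?_ heJ)
    rw [abs_neg, abs_mul, abs_of_nonneg hδ0]
    gcongr
  -- By smallness `J'` differs from `J ≥ 1 / B` by at most `1 / (2 B)`, so the perturbed denominator
  -- stays away from zero.
  have hJ' : 1 ≤ 2 * B * J' := by
    have := (abs_le.1 hJJ').2
    nlinarith
  have hJ'0 : 0 < J' := pos_of_mul_pos_right (by linarith) (by positivity : 0 ≤ 2 * B)
  have hiJ : J⁻¹ ≤ B := by rw [inv_le_iff_one_le_mul₀ hJ0]; exact hJ
  have hiJ' : J'⁻¹ ≤ 2 * B := by rw [inv_le_iff_one_le_mul₀ hJ'0]; exact hJ'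
  -- Exact remainder: the first term is the cost of replacing `J'` by `J` in the denominator of the
  -- linear part, the second collects the errors of `I'` and `J'`.
  have h1 : I / J - I' / J' - δ * (I * J₁ - I₁ * J) / J ^ 2
      = J⁻¹ ^ 2 * J'⁻¹ * (δ * (I * J₁ - I₁ * J)) * (J - J')
        + J⁻¹ * J'⁻¹ * (I * (J' - (J + δ * J₁)) - (I' - (I + δ * I₁)) * J) := by
    field_simp
    ring
  have h2 : |δ * (I * J₁ - I₁ * J)| ≤ δ * (2 * K ^ 2) := by
    rw [abs_mul, abs_of_nonneg hδ0]
    gcongr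
    calc _ ≤ |I * J₁| + |I₁ * J| := abs_sub _ _
      _ ≤ K * K + K * K := by rw [abs_mul, abs_mul]; gcongr
      _ = _ := by ring
  have h3 : |I * (J' - (J + δ * J₁)) - (I' - (I + δ * I₁)) * J| ≤ 2 * K * e := by
    calc _ ≤ |I * (J' - (J + δ * J₁))| + |(I' - (I + δ * I₁)) * J| := abs_sub _ _
      _ ≤ K * e + e * K := by rw [abs_mul, abs_mul]; gcongr
      _ = _ := by ring
  have hi0 : 0 ≤ J⁻¹ := by positivity
  have hi0' : 0 ≤ J'⁻¹ := by positivity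
  rw [h1]
  refine (abs_add_le _ _).trans (add_le_add ?_ ?_)
  · rw [abs_mul, abs_mul, abs_of_nonneg (by positivity : 0 ≤ J⁻¹ ^ 2 * J'⁻¹)]
    calc _ ≤ B ^ 2 * (2 * B) * (δ * (2 * K ^ 2)) * (δ * K + e) := by gcongr
      _ = _ := by ring
  · rw [abs_mul, abs_of_nonneg (by positivity : 0 ≤ J⁻¹ * J'⁻¹)]
    calc _ ≤ B * (2 * B) * (2 * K * e) := by gcongr
      _ = _ := by ring

end Scatter

/-! ### The augmentation graph -/

section Graph

variable {N : ℕ} {Ω : Type*} [MeasurableSpace Ω]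

lemma labelConn_nonneg (Pl : Measure Ω) (T : Kernel Ω (Fin N)) (x : Fin N) :
    0 ≤ labelConn Pl T x :=
  integral_nonneg fun _ => measureReal_nonneg

lemma sum_labelConn (Pl : Measure Ω) [IsProbabilityMeasure Pl] (T : Kernel Ω (Fin N))
    [IsMarkovKernel T] : ∑ x, labelConn Pl T x = 1 := by
  have hint : ∀ x ∈ Finset.univ, Integrable (fun ω => (T ω).real {x}) Pl := fun x _ => by
    refine Integrable.of_bound
      (Kernel.measurable_coe T (measurableSet_singleton x)).ennreal_toReal.aestronglyMeasurable 1
      (Filter.Eventually.of_forall fun ω => ?_)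
    rw [Real.norm_of_nonneg measureReal_nonneg]
    exact measureReal_le_one
  simp only [labelConn]
  rw [← integral_finsetSum _ hint]
  have : ∀ ω, ∑ x, (T ω).real {x} = 1 := fun ω => by
    rw [sum_measureReal_singleton]
    simp
  simp [this]

lemma selfAdj_nonneg (P : Measure Ω) (T : Kernel Ω (Fin N)) (x y : Fin N) :
    0 ≤ selfAdj P T x y :=
  integral_nonneg fun _ => mul_nonneg measureReal_nonneg measureReal_nonneg

lemma adj_zero_apply (ηu : ℝ) (P Pl : Measure Ω) (T : Kernel Ω (Fin N)) (x y : Fin N) :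
    adj ηu P Pl T 0 x y = ηu * selfAdj P T x y := by
  simp [adj]

/-- No sign of `ηu` is assumed: a row sum equal to one, with nonnegative entries of `selfAdj`,
forces it to be positive. -/
lemma adj_zero_nonneg {ηu : ℝ} {P Pl : Measure Ω} {T : Kernel Ω (Fin N)}
    (h : ∀ x, deg (adj ηu P Pl T 0) x = 1) (x y : Fin N) : 0 ≤ adj ηu P Pl T 0 x y := by
  have h1 := h x
  simp only [deg, adj_zero_apply, ← Finset.mul_sum] at h1
  have h2 : 0 ≤ ∑ z, selfAdj P T x z := Finset.sum_nonneg fun z _ => selfAdj_nonneg P T x z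
  have h3 : 0 < ηu := pos_of_mul_pos_left (by linarith) h2
  rw [adj_zero_apply]
  exact mul_nonneg h3.le (selfAdj_nonneg P T x y)

lemma adj_eq_add (ηu : ℝ) (P Pl : Measure Ω) (T : Kernel Ω (Fin N)) (δ : ℝ) :
    adj ηu P Pl T δ
      = adj ηu P Pl T 0 + δ • Matrix.vecMulVec (labelConn Pl T) (labelConn Pl T) := by
  simp [adj]

end Graph

/-! ### The spectral gap -/

lemma singVal_nonneg {N : ℕ} {σ : Fin N → ℝ} (h : ∀ j, 0 ≤ σ j) (j : ℕ) : 0 ≤ singVal σ j := by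
  unfold singVal
  split_ifs
  · exact h _
  · exact le_rfl

lemma singVal_le {N k : ℕ} (hk : 1 ≤ k) {σ : Fin N → ℝ} (hanti : Antitone σ)
    (hσ : ∀ j, 0 ≤ σ j) {j : Fin N} (hj : j.val < k) : singVal σ k ≤ σ j := by
  unfold singVal
  split_ifs
  · exact hanti (show j.val ≤ k - 1 by omega)
  · exact hσ j

/-- `singVal` counts from one and `σ` from zero, so `singVal σ (k + 1)` is the entry with index `k`.
-/
lemma le_singVal {N k : ℕ} {σ : Fin N → ℝ} (hanti : Antitone σ)
    {j : Fin N} (hj : k ≤ j.val) : σ j ≤ singVal σ (k + 1) := by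
  have : k + 1 - 1 < N := by have := j.isLt; omega
  rw [singVal, dif_pos this]
  exact hanti (show k + 1 - 1 ≤ j.val by omega)

/-- The inverse gap is the small real parameter of the expansion; it is `0` for an infinite gap, and
the product form covers that case. A vanishing `k`-th singular value would make the gap `0`, also
for `0 / 0`. -/
lemma spectralGap_spec {N k : ℕ} {σ : Fin N → ℝ} (hσ : ∀ j, 0 ≤ σ j) {G : ℝ} (hG : 0 < G)
    (hgap : ENNReal.ofReal G ≤ spectralGap σ k) :
    0 < singVal σ k ∧ singVal σ (k + 1) = singVal σ k * (spectralGap σ k)⁻¹.toReal ∧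
      (spectralGap σ k)⁻¹.toReal ≤ G⁻¹ := by
  have ha : 0 < singVal σ k := by
    by_contra h
    rw [spectralGap, ENNReal.ofReal_of_nonpos (not_lt.1 h), ENNReal.zero_div] at hgap
    have := ENNReal.ofReal_pos.2 hG
    exact absurd hgap this.not_ge
  refine ⟨ha, ?_, ?_⟩
  · rw [spectralGap, ENNReal.inv_div (Or.inl ENNReal.ofReal_ne_top)
      (Or.inr (ENNReal.ofReal_pos.2 ha).ne'), ENNReal.toReal_div,
      ENNReal.toReal_ofReal ha.le, ENNReal.toReal_ofReal (singVal_nonneg hσ _)]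
    field_simp
  · have h1 := ENNReal.inv_le_inv.2 hgap
    rw [← ENNReal.ofReal_inv_of_pos hG] at h1
    have h2 := ENNReal.toReal_mono ENNReal.ofReal_ne_top h1
    rwa [ENNReal.toReal_ofReal (by positivity)] at h2

/-! ### Expansion of the K-means measure -/

section Expansion

/-- Bound on the scatters and on their derivatives. -/
def scatterBound (N : ℕ) : ℝ := 2 * N * (2 * N + 1)

/-- Constant in the second-order error of the scatters. -/
def scatterErr (N : ℕ) : ℝ := 80 * N * (N + 1)

/-- Constant in the error of the expansion of the K-means measure. -/
def kmsErr (N : ℕ) (B : ℝ) : ℝ :=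
  4 * B ^ 3 * scatterBound N ^ 2 * (scatterBound N + scatterErr N)
    + 4 * B ^ 2 * scatterBound N * scatterErr N + 1

lemma scatterBound_nonneg (N : ℕ) : 0 ≤ scatterBound N := by unfold scatterBound; positivity

lemma scatterErr_nonneg (N : ℕ) : 0 ≤ scatterErr N := by unfold scatterErr; positivity

/-- The summand `1` matters here: the two scatter constants vanish for `N = 0`. -/
lemma kmsErr_pos (N : ℕ) {B : ℝ} (hB : 0 ≤ B) : 0 < kmsErr N B := by
  have := scatterBound_nonneg N
  have := scatterErr_nonneg N
  unfold kmsErr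
  positivity

variable {N k : ℕ}

lemma abs_simPert_le {Γ : Fin N → Fin N → ℝ} {l : Fin N → ℝ} (hΓ : ∀ i j, |Γ i j| ≤ N)
    (hl0 : ∀ i, 0 ≤ l i) (hl1 : ∀ i, l i ≤ 1) (i j : Fin N) :
    |simPert Γ l i j| ≤ 2 * N + 1 := by
  have h1 : |l i * l j| ≤ 1 := by
    rw [abs_of_nonneg (mul_nonneg (hl0 i) (hl0 j))]
    exact mul_le_one₀ (hl1 i) (hl0 j) (hl1 j)
  have h2 : |(l i + l j) * Γ i j| ≤ 2 * N := by
    rw [abs_mul, abs_of_nonneg (add_nonneg (hl0 i) (hl0 j))]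
    have := hl1 i
    have := hl1 j
    gcongr
    · linarith
    · exact hΓ i j
  rw [simPert]
  linarith [abs_sub (l i * l j) ((l i + l j) * Γ i j)]

/-- The expansion of the similarities is fed through the two linear scatters and the quotient rule.
The surplus from the decrease of the intra-class scatter is kept, since it later pays for the error.
-/
theorem kms_sub_ge (hk : 1 ≤ k) (hkN : k ≤ N) {A : Matrix (Fin N) (Fin N) ℝ}
    (hA0 : ∀ x y, 0 ≤ A x y) (hA1 : ∀ x, deg A x = 1) {l : Fin N → ℝ} (hl0 : ∀ x, 0 ≤ l x)
    (hl1 : ∑ x, l x = 1) {δ B : ℝ} (hB : 1 ≤ B) (hδ0 : 0 ≤ δ)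
    (hδ : δ ≤ (2 * B * (scatterBound N + 2 * scatterErr N) + 1)⁻¹)
    {σ σ' : Fin N → ℝ} {v v' : Fin N → EuclideanSpace ℝ (Fin N)}
    {Z Z' : Fin N → EuclideanSpace ℝ (Fin k)}
    (hZ : IsSpectralRep A σ v Z) (hZ' : IsSpectralRep (A + δ • Matrix.vecMulVec l l) σ' v' Z')
    (hl : WithLp.toLp 2 l ∈ Submodule.span ℝ (v '' {j | j.val < k}))
    {Q : Finpartition (Finset.univ : Finset (Fin N))} {lc : Finset (Fin N) → ℝ}
    (hlc : ∀ c ∈ Q.parts, ∀ i ∈ c, l i = lc c)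
    (hQ : 1 ≤ B * interClass Q Z) (hgap : ENNReal.ofReal 16 ≤ spectralGap σ k) :
    interClass Q Z ≤ scatterBound N ∧
    kms Q Z - kms Q Z' ≥
      δ * (1 / interClass Q Z) * (intraClass Q Z / interClass Q Z)
          * ∑ c ∈ Q.parts, (c.card : ℝ) * lc c * classPert Z (lc c) c
        + 2 * δ * (1 / interClass Q Z)
          * ∑ c ∈ Q.parts, lc c * ∑ i ∈ c, ‖Z i - center Z c‖ ^ 2
        - kmsErr N B * (δ * (spectralGap σ k)⁻¹.toReal + δ ^ 2) := by
  set ε := (spectralGap σ k)⁻¹.toReal with hεdef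
  obtain ⟨ha, hhi, hε16⟩ := spectralGap_spec hZ.svd.nonneg (by norm_num : (0 : ℝ) < 16) hgap
  rw [← hεdef] at hhi hε16
  have hε0 : 0 ≤ ε := ENNReal.toReal_nonneg
  have hK0 := scatterBound_nonneg N
  have hc0 := scatterErr_nonneg N
  have hB0 : 0 ≤ B := by linarith
  have hd0 : 0 ≤ 2 * B * (scatterBound N + 2 * scatterErr N) := by positivity
  have hδ1 : δ ≤ 1 := hδ.trans (inv_le_one_of_one_le₀ (by linarith))
  have hl1' : ∀ x, l x ≤ 1 := fun x => by
    rw [← hl1]; exact Finset.single_le_sum (fun y _ => hl0 y) (Finset.mem_univ x)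
  have hloN : singVal σ k ≤ N := by
    have hsvd := hZ.svd
    rw [normAdj_of_deg_one hA1] at hsvd
    exact (singVal_le hk hZ.svd.antitone hZ.svd.nonneg
      (show (⟨k - 1, by omega⟩ : Fin N).val < k by simp; omega)).trans (hsvd.le_card hA0 hA1 _)
  have hgram := abs_gram_sub_le hA0 hA1 hl0 hl1 hδ0 hδ1 hZ hZ' hl ha
    (fun j hj => singVal_le hk hZ.svd.antitone hZ.svd.nonneg hj) hloN
    (singVal_nonneg hZ.svd.nonneg _) (fun j hj => le_singVal hZ.svd.antitone hj) hhi
    (by linarith)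
  set Γ : Fin N → Fin N → ℝ := fun i j => inner ℝ (Z i) (Z j) with hΓ
  set Γ' : Fin N → Fin N → ℝ := fun i j => inner ℝ (Z' i) (Z' j) with hΓ'
  set η := δ * ε + δ ^ 2 with hη
  have hη0 : 0 ≤ η := by positivity
  have hηδ : η ≤ 2 * δ := by nlinarith
  have hΓN : ∀ i j, |Γ i j| ≤ N := fun i j => (hgram i j).1
  have hN0 : (0 : ℝ) ≤ N := Nat.cast_nonneg N
  have hsp := abs_simPert_le hΓN hl0 hl1'
  -- The difference is written with coefficient `-1` so that the linearity lemmas apply to it twice.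
  have hErr : ∀ i j, |Γ' i j + (-1) * (Γ i j + δ * simPert Γ l i j)| ≤ 40 * (N + 1) * η :=
    fun i j => by
      have h := (hgram i j).2
      rw [neg_one_mul, ← sub_eq_add_neg]
      exact h
  have e1 : |intraSim Q Γ' - (intraSim Q Γ + δ * intraSim Q (simPert Γ l))|
      ≤ scatterErr N * η := by
    have h := abs_intraSim_le (Q := Q) hErr
    rw [intraSim_linear, intraSim_linear, neg_one_mul, ← sub_eq_add_neg] at h
    exact h.trans_eq (by unfold scatterErr; ring)
  have e2 : |interSim Q Γ' - (interSim Q Γ + δ * interSim Q (simPert Γ l))|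
      ≤ scatterErr N * η := by
    have h := abs_interSim_le (Q := Q) hErr
    rw [interSim_linear, interSim_linear, neg_one_mul, ← sub_eq_add_neg] at h
    exact h.trans_eq (by unfold scatterErr; ring)
  have hNK : 2 * (N : ℝ) * N ≤ scatterBound N := by unfold scatterBound; nlinarith
  have hJK := (abs_interSim_le (Q := Q) hΓN).trans hNK
  rw [interClass_eq, ← hΓ] at hQ
  -- The threshold for `δ` is designed for this estimate, using `η ≤ 2 δ`; its summand `1` also
  -- gives `δ ≤ 1`.
  have hsmall : 2 * B * (δ * scatterBound N + scatterErr N * η) ≤ 1 := by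
    calc _ ≤ 2 * B * (δ * scatterBound N + scatterErr N * (2 * δ)) := by gcongr
      _ = δ * (2 * B * (scatterBound N + 2 * scatterErr N)) := by ring
      _ ≤ (2 * B * (scatterBound N + 2 * scatterErr N) + 1)⁻¹
          * (2 * B * (scatterBound N + 2 * scatterErr N)) := by gcongr
      _ ≤ 1 := by
        rw [inv_mul_le_iff₀ (by linarith)]
        linarith
  have key := abs_div_sub_div_sub_le hB hδ0 hK0 ((abs_intraSim_le hΓN).trans hNK)
    (abs_intraSim_le hsp) (abs_interSim_le hsp) hJK hQ e1 e2 hsmall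
  have hJ0 : 0 < interSim Q Γ := pos_of_mul_pos_right (by linarith) hB0
  have hbound : 2 * B ^ 3 * (δ * (2 * scatterBound N ^ 2))
        * (δ * scatterBound N + scatterErr N * η)
        + 2 * B ^ 2 * (2 * scatterBound N * (scatterErr N * η)) ≤ kmsErr N B * η := by
    have h1 : δ * (δ * scatterBound N + scatterErr N * η)
        ≤ (scatterBound N + scatterErr N) * η := by
      have h2 : δ ^ 2 ≤ η := by rw [hη]; nlinarith [mul_nonneg hδ0 hε0]
      have h3 : scatterErr N * η * δ ≤ scatterErr N * η * 1 := by gcongr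
      nlinarith [mul_le_mul_of_nonneg_left h2 hK0]
    calc _ = 4 * B ^ 3 * scatterBound N ^ 2 * (δ * (δ * scatterBound N + scatterErr N * η))
          + 4 * B ^ 2 * scatterBound N * scatterErr N * η := by ring
      _ ≤ 4 * B ^ 3 * scatterBound N ^ 2 * ((scatterBound N + scatterErr N) * η)
          + 4 * B ^ 2 * scatterBound N * scatterErr N * η := by gcongr
      _ ≤ kmsErr N B * η := by unfold kmsErr; linarith
  have hsc : ∑ c ∈ Q.parts, lc c * ∑ i ∈ c, ‖Z i - center Z c‖ ^ 2
      = ∑ c ∈ Q.parts, lc c * scatter Γ c :=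
    Finset.sum_congr rfl fun c _ => by rw [sum_norm_sub_center_sq]
  refine ⟨by rw [interClass_eq]; exact (le_abs_self _).trans hJK, ?_⟩
  rw [hsc, kms, kms, intraClass_eq, intraClass_eq, interClass_eq, interClass_eq, ← hΓ, ← hΓ',
    ← interSim_simPert Z hl1 hlc, ← hΓ]
  have h1 := (abs_le.1 (key.trans hbound)).1
  rw [intraSim_simPert hlc] at h1
  have h2 : δ * (intraSim Q Γ * interSim Q (simPert Γ l)
        - -(2 * ∑ c ∈ Q.parts, lc c * scatter Γ c) * interSim Q Γ) / interSim Q Γ ^ 2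
      = δ * (1 / interSim Q Γ) * (intraSim Q Γ / interSim Q Γ) * interSim Q (simPert Γ l)
        + 2 * δ * (1 / interSim Q Γ) * ∑ c ∈ Q.parts, lc c * scatter Γ c := by
    field_simp
    ring
  rw [h2] at h1
  linarith

end Expansion

end SORL

/-! ### Choice of the constants and conclusion -/

theorem mainTheorem6 (N : ℕ) (B : ℝ) :
    ∃ G₀ δ₀ C : ℝ, 0 < G₀ ∧ 0 < δ₀ ∧ 0 < C ∧
    ∀ s : ℝ, 0 < s → ∃ G₁ δ₁ : ℝ, 0 < G₁ ∧ 0 < δ₁ ∧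
    ∀ (Ω : Type*) [MeasurableSpace Ω] (P Pl : Measure Ω) [IsProbabilityMeasure P]
      [IsProbabilityMeasure Pl] (T : Kernel Ω (Fin N)) [IsMarkovKernel T] (ηu : ℝ),
      -- all degrees of the unlabeled graph are equal to one
      (∀ x, SORL.deg (SORL.adj ηu P Pl T 0) x = 1) →
    ∀ (k : ℕ), 1 ≤ k → k ≤ N →
    -- the representations before and after adding the labels
    ∀ (σ : Fin N → ℝ) (v : Fin N → EuclideanSpace ℝ (Fin N))
      (Z : Fin N → EuclideanSpace ℝ (Fin k)),
      SORL.IsSpectralRep (SORL.adj ηu P Pl T 0) σ v Z →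
    ∀ (δ : ℝ), 0 < δ →
    ∀ (σ' : Fin N → ℝ) (v' : Fin N → EuclideanSpace ℝ (Fin N))
      (Z' : Fin N → EuclideanSpace ℝ (Fin k)),
      SORL.IsSpectralRep (SORL.adj ηu P Pl T δ) σ' v' Z' →
      -- the label connection lies in the span of the top-`k` singular vectors
      WithLp.toLp 2 (SORL.labelConn Pl T) ∈ Submodule.span ℝ (v '' {j | j.val < k}) →
    -- the label connection is constant on every class
    ∀ (Q : Finpartition (Finset.univ : Finset (Fin N))) (l : Finset (Fin N) → ℝ),
      (∀ c ∈ Q.parts, ∀ i ∈ c, SORL.labelConn Pl T i = l c) →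
    ∀ (η₁ η₂ : ℝ), η₁ = 1 / SORL.interClass Q Z →
      η₂ = SORL.intraClass Q Z / SORL.interClass Q Z → 0 < η₁ → η₁ ≤ B →
      -- the bound up to the error terms of the perturbation expansion
      (ENNReal.ofReal G₀ ≤ SORL.spectralGap σ k → δ ≤ δ₀ →
        SORL.kms Q Z - SORL.kms Q Z' ≥
          δ * η₁ * η₂ * ∑ c ∈ Q.parts, (c.card : ℝ) * l c * SORL.classPert Z (l c) c
            - C * (δ * (SORL.spectralGap σ k)⁻¹.toReal + δ ^ 2)) ∧
      -- the bound without error terms, if the classes connected to the labeled data have scatter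
      (ENNReal.ofReal G₁ ≤ SORL.spectralGap σ k → δ ≤ δ₁ →
        s ≤ ∑ c ∈ Q.parts, l c * ∑ i ∈ c, ‖Z i - SORL.center Z c‖ ^ 2 →
        SORL.kms Q Z - SORL.kms Q Z' ≥
          δ * η₁ * η₂ * ∑ c ∈ Q.parts, (c.card : ℝ) * l c * SORL.classPert Z (l c) c ∧
        -- clustering improves if all connections exceed the self-clusterability
        ((∀ c ∈ Q.parts, 0 < l c → SORL.selfClusterability Z c < l c - 1 / (N : ℝ)) →
          SORL.kms Q Z' < SORL.kms Q Z)) ∧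
      -- the sign of the contribution of a single class
      (∀ c ∈ Q.parts, 0 < l c →
        (0 < (c.card : ℝ) * l c * SORL.classPert Z (l c) c ↔
          SORL.selfClusterability Z c < l c - 1 / (N : ℝ))) := by
  -- The constants are fixed before anything is known about the sign of `B`, so `|B| + 1` serves as
  -- the bound.
  have hB1 : 1 ≤ |B| + 1 := by linarith [abs_nonneg B]
  have hK0 := SORL.scatterBound_nonneg N
  have hc0 := SORL.scatterErr_nonneg N
  have hd0 : 0 ≤ 2 * (|B| + 1) * (SORL.scatterBound N + 2 * SORL.scatterErr N) := by positivity
  have hC := SORL.kmsErr_pos N (zero_le_one.trans hB1)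
  obtain ⟨K, hK⟩ : ∃ K, SORL.scatterBound N = K := ⟨_, rfl⟩
  obtain ⟨C, hCdef⟩ : ∃ C, SORL.kmsErr N (|B| + 1) = C := ⟨_, rfl⟩
  rw [hK] at hK0 hd0
  rw [hCdef] at hC
  refine ⟨16, (2 * (|B| + 1) * (K + 2 * SORL.scatterErr N) + 1)⁻¹, C, by norm_num,
    inv_pos.2 (by linarith), hC, fun s hs => ?_⟩
  -- With these thresholds both the inverse gap and `δ` are at most `s / (2 C (K + 1))`, so each
  -- error term is at most half of `δ s / (K + 1)`. The surplus is at least `2 δ s / (K + 1)`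
  -- because `η₁ ≥ 1 / (K + 1)`, which leaves a strictly positive remainder.
  refine ⟨16 + 2 * C * (K + 1) / s,
    min (2 * (|B| + 1) * (K + 2 * SORL.scatterErr N) + 1)⁻¹ (s / (2 * C * (K + 1))),
    by positivity, lt_min (inv_pos.2 (by linarith)) (by positivity), ?_⟩
  intro Ω _ P Pl _ _ T _ ηu hdeg k hk hkN σ v Z hZ δ hδ σ' v' Z' hZ' hl Q l hlc η₁ η₂ hη₁ hη₂
    hη₁0 hη₁B
  have hJ0 : 0 < SORL.interClass Q Z := by rw [hη₁] at hη₁0; exact one_div_pos.1 hη₁0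
  have hl0 : ∀ c ∈ Q.parts, 0 ≤ l c := fun c hc => by
    obtain ⟨i, hi⟩ := Q.nonempty_of_mem_parts hc
    rw [← hlc c hc i hi]
    exact SORL.labelConn_nonneg Pl T i
  have hη₂0 : 0 ≤ η₂ := by
    rw [hη₂]
    exact div_nonneg (Finset.sum_nonneg fun c _ => Finset.sum_nonneg fun i _ => by positivity)
      hJ0.le
  have hQ : 1 ≤ (|B| + 1) * SORL.interClass Q Z := by
    have h : 1 ≤ B * SORL.interClass Q Z := by rwa [hη₁, div_le_iff₀ hJ0] at hη₁B
    nlinarith [le_abs_self B]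
  rw [SORL.adj_eq_add] at hZ'
  have main := fun hδ' hgap => SORL.kms_sub_ge hk hkN (SORL.adj_zero_nonneg hdeg) hdeg
    (SORL.labelConn_nonneg Pl T) (SORL.sum_labelConn Pl T) hB1 hδ.le hδ' hZ hZ' hl hlc hQ hgap
  rw [← hη₁, ← hη₂, hK, hCdef] at main
  have hpert : ∀ c, SORL.classPert Z (l c) c = l c - 1 / (N : ℝ) - SORL.selfClusterability Z c :=
    fun c => rfl
  refine ⟨fun hgap hδ' => ?_, fun hgap hδ' hsc => ?_, fun c hc hlpos => ?_⟩
  · have h1 := (main hδ' hgap).2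
    have h2 : 0 ≤ ∑ c ∈ Q.parts, l c * ∑ i ∈ c, ‖Z i - SORL.center Z c‖ ^ 2 :=
      Finset.sum_nonneg fun c hc => mul_nonneg (hl0 c hc)
        (Finset.sum_nonneg fun i _ => by positivity)
    have h3 := mul_nonneg (by positivity : 0 ≤ 2 * δ * η₁) h2
    linarith
  · have hG : 0 < 2 * C * (K + 1) / s := by positivity
    obtain ⟨h0, h1⟩ := main (hδ'.trans (min_le_left _ _))
      ((ENNReal.ofReal_le_ofReal (by linarith : (16 : ℝ) ≤ 16 + 2 * C * (K + 1) / s)).trans hgap)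
    have hε : (SORL.spectralGap σ k)⁻¹.toReal ≤ s / (2 * C * (K + 1)) := by
      refine (SORL.spectralGap_spec hZ.svd.nonneg (by positivity) hgap).2.2.trans ?_
      rw [← inv_div (2 * C * (K + 1)) s]
      exact inv_anti₀ hG (by linarith)
    have hηK : 1 / (K + 1) ≤ η₁ := by
      rw [hη₁]
      exact one_div_le_one_div_of_le hJ0 (by linarith)
    have h2 : C * (δ * (SORL.spectralGap σ k)⁻¹.toReal + δ ^ 2) ≤ δ * (1 / (K + 1)) * s := by
      calc _ ≤ C * (δ * (s / (2 * C * (K + 1))) + δ * (s / (2 * C * (K + 1)))) := by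
            rw [sq]
            gcongr
            exact hδ'.trans (min_le_right _ _)
        _ = _ := by field_simp; ring
    have h3 : 2 * δ * (1 / (K + 1)) * s ≤
        2 * δ * η₁ * ∑ c ∈ Q.parts, l c * ∑ i ∈ c, ‖Z i - SORL.center Z c‖ ^ 2 := by gcongr
    have h4 : 0 < δ * (1 / (K + 1)) * s := by positivity
    refine ⟨by linarith, fun hpos => ?_⟩
    have h5 : 0 ≤ ∑ c ∈ Q.parts, (c.card : ℝ) * l c * SORL.classPert Z (l c) c := by
      refine Finset.sum_nonneg fun c hc => ?_
      rcases (hl0 c hc).eq_or_lt with h | h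
      · rw [← h]; simp
      · have := hpos c hc h
        rw [hpert]
        exact mul_nonneg (by positivity) (by linarith)
    have h6 := mul_nonneg (by positivity : 0 ≤ δ * η₁ * η₂) h5
    linarith
  · have hcard : (0 : ℝ) < c.card := by exact_mod_cast (Q.nonempty_of_mem_parts hc).card_pos
    rw [hpert, mul_pos_iff_of_pos_left (by positivity), sub_pos]
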